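/- **Setting.** A stochastic combinatorial semi-bandit has base arms $[m]$, a nonempty family $\mathcal S$ of super arms $S\subseteq[m]$ with $|S|\le K$, an unknown law $D$ on $[0,1]^m$ with mean vector $\mu$, and expected rewards $r_\nu(S)\ge 0$ ($\nu\in[0,1]^m$, $S\in\mathcal S$). In every round $t$ an outcome vector $X_t\sim D$ is drawn independently of the past; playing $S_t\in\mathcal S$ reveals $X_{t,i}$ for $i\in S_t$. Assume, for all $\nu,\nu'\in[0,1]^m$ and $S\in\mathcal S$, monotonicity ($\nu\le\nu'$ coordinatewise implies $r_\nu(S)\le r_{\nu'}(S)$) and $B_1$-bounded smoothness ($|r_\nu(S)-r_{\nu'}(S)|\le B_1\sum_{i\in S}|\nu_i-\nu'_i|$), $B_1>0$. Let $\alpha,\beta\in(0,1]$, and let $\mathrm{Oracle}$ be a randomized map which for every $\nu\in[0,1]^m$ returns $S\in\mathcal S$ with $\Pr[r_\nu(S)\ge\alpha\max_{S'\in\mathcal S}r_\nu(S')]\ge\beta$. Put $\mathrm{opt}=\max_{S\in\mathcal S}r_\mu(S)$, $\Delta_S=\alpha\,\mathrm{opt}-r_\mu(S)$, $\Delta^i_{\min}=\min\{\Delta_S: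 S\in\mathcal S,\ i\in S,\ \Delta_S>0\}$ and $\Delta_{\max}=\max\{\Delta_S: S\in\mathcal S,\ \Delta_S>0\}$ (each $0$ if the set is empty), and $$Reg_{\mu,\alpha,\beta}(T)=T\alpha\beta\,\mathrm{opt}-\mathbb E\Big[\sum_{t=1}^T r_\mu(S_t)\Big].$$ **Algorithm CUCB-DP** (horizon $T\ge2$, privacy parameter $\varepsilon>0$). Let $T_{t,i}$ be the number of rounds $\tau\le t$ with $i\in S_\tau$. In round $t$ put $$\bar\mu_{t-1}(i)=\min\Big\{\tilde\mu_{t-1}(i)+\sqrt{\tfrac{4\ln(mT)}{T_{t-1,i}}}+\tfrac{12K\ln^3T}{T_{t-1,i}\,\varepsilon},\,1\Big\}$$ ($=1$ if $T_{t-1,i}=0$), and play $S_t=\mathrm{Oracle}(\bar\mu_{t-1})$ if $\bar\mu_{t-1}\ge0$ coordinatewise, and an arbitrary super arm (which may depend on $t$, $\bar\mu_{t-1}$ and fresh randomness) otherwise. For $i\in S_t$ set $\tilde\mu_t(i)=A_t(i)/T_{t,i}$; for $i\notin S_t$ set $\tilde\mu_t(i)=\tilde\mu_{t-1}(i)$.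 Here $A_t(i)$ is the output of tree-based aggregation: the node $(\ell,q)$ ($\ell\ge0$, $q\ge1$) of a binary tree over the rounds holds the sum of $X_{\tau,i}\mathbf 1\{i\in S_\tau\}$ over $(q-1)2^\ell<\tau\le q2^\ell$ plus its own noise of law $\mathrm{Lap}(2K\log_2T/\varepsilon)$, independent over nodes and base arms, and $A_t(i)$ is the sum of the noisy values of the nodes $(\ell,\lfloor t/2^\ell\rfloor)$ over the positions $\ell$ of the binary digits $1$ of $t$ (these nodes partition $\{1,\dots,t\}$). Outcomes, noises and the random seeds of the rounds are independent. **Theorem.** There is a universal constant $C>0$ such that for every such instance, every $\varepsilon>0$ and every $T\ge2$, with $\ln^+x=\max\{0,\ln x\}$ for $x>0$ and $\ln^+0=0$ (and a quotient with denominator $0$ read as $0$), $$Reg_{\mu,\alpha,\beta}(T)\le C\sum_{i:\Delta^i_{\min}>0}\frac{KB_1^2\ln^2T}{\Delta^i_{\min}}+C\,\frac{mKB_1\ln^3T}{\varepsilon}\Big(1+\ln^+\frac{B_1K\ln T}{\Delta_{\max}\varepsilon}+\ln^+\frac{\Delta_{\max}}{B_1}\Big)+C\,m\,\Delta_{\max}.$$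 Moreover, if $\Delta_{\max}>0$ and $\frac{B_1K\ln T}{\Delta_{\max}\varepsilon}\ge\max\{e,\Delta_{\max}/B_1\}$ (which, if $K\geq 1$, holds for all sufficiently large $T$), then $$Reg_{\mu,\alpha,\beta}(T)\le C\sum_{i:\Delta^i_{\min}>0}\frac{KB_1^2\ln^2T}{\Delta^i_{\min}}+C\,\frac{mKB_1\ln^3T\,\ln\big(\frac{B_1K\ln T}{\Delta_{\max}\varepsilon}\big)}{\varepsilon}.$$ -/

import Mathlib

open MeasureTheory
open scoped Real

namespace DPCSB

/-! ### The combinatorial semi-bandit model -/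

/-- The cube `[0,1]^m` of mean vectors and outcome vectors. -/
def cube (m : ℕ) : Set (Fin m → ℝ) := {x | ∀ i, 0 ≤ x i ∧ x i ≤ 1}

/-- A stochastic combinatorial semi-bandit with `m` base arms. In every round an outcome vector
is drawn, independently of the past, from the (unknown) law `law` on `[0,1]^m`; outcomes of
different base arms may be correlated. Playing the super arm `S` has expected reward
`reward μ S`, where `μ` is the vector of mean outcomes, and reveals the outcomes of the
base arms in `S`. -/
structure SemiBandit (m : ℕ) where
  /-- the feasible super arms -/
  superArms : Finset (Finset (Fin m))
  superArms_nonempty : superArms.Nonempty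
  /-- the bound on the size of a super arm -/
  K : ℕ
  card_le : ∀ S ∈ superArms, S.card ≤ K
  /-- the joint law of the outcomes of the base arms in one round -/
  law : Measure (Fin m → ℝ)
  isProbabilityMeasure_law : IsProbabilityMeasure law
  law_cube : ∀ᵐ x ∂law, x ∈ cube m
  /-- the expected reward of a super arm, as a function of the mean vector -/
  reward : (Fin m → ℝ) → Finset (Fin m) → ℝ
  reward_nonneg : ∀ ν ∈ cube m, ∀ S ∈ superArms, 0 ≤ reward ν S

namespace SemiBandit

attribute [instance] isProbabilityMeasure_law

variable {m : ℕ} (M : SemiBandit m)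

/-- The true mean vector `μ`. -/
noncomputable def mean (i : Fin m) : ℝ := ∫ x, x i ∂M.law

/-- The optimal expected reward for the mean vector `ν`. -/
noncomputable def opt (ν : Fin m → ℝ) : ℝ := M.superArms.sup' M.superArms_nonempty (M.reward ν)

/-- Monotonicity of the expected reward in the mean vector. -/
def IsMonotone : Prop :=
  ∀ ν ∈ cube m, ∀ ν' ∈ cube m, (∀ i, ν i ≤ ν' i) →
    ∀ S ∈ M.superArms, M.reward ν S ≤ M.reward ν' S

/-- `B₁`-bounded smoothness of the expected reward. -/
def IsBoundedSmooth (B₁ : ℝ) : Prop :=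
  ∀ ν ∈ cube m, ∀ ν' ∈ cube m, ∀ S ∈ M.superArms,
    |M.reward ν S - M.reward ν' S| ≤ B₁ * ∑ i ∈ S, |ν i - ν' i|

/-- The gap `Δ_S = α r_μ(S*) - r_μ(S)`. -/
noncomputable def gap (α : ℝ) (S : Finset (Fin m)) : ℝ := α * M.opt M.mean - M.reward M.mean S

/-- `Δ^i_min`: the smallest positive gap of a super arm containing `i`, and `0` if there is no
such super arm (the infimum is over a finite set, so it is attained, hence positive, as soon as
the set is nonempty). -/
noncomputable def gapMin (α : ℝ) (i : Fin m) : ℝ :=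
  sInf {d | ∃ S ∈ M.superArms, i ∈ S ∧ 0 < M.gap α S ∧ d = M.gap α S}

/-- `Δ_max`: the largest positive gap of a super arm, and `0` if no gap is positive. -/
noncomputable def gapMax (α : ℝ) : ℝ :=
  sSup {d | ∃ S ∈ M.superArms, 0 < M.gap α S ∧ d = M.gap α S}

/-- An `(α,β)`-approximation oracle with internal randomness in `Ξ`: on input `ν ∈ [0,1]^m` it
returns a super arm whose reward under `ν` is at least `α` times the optimal one, with
probability at least `β`. -/
structure Oracle (α β : ℝ) (Ξ : Type*) [MeasurableSpace Ξ] where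
  /-- the law of the random seed -/
  seedLaw : Measure Ξ
  isProbabilityMeasure_seedLaw : IsProbabilityMeasure seedLaw
  run : (Fin m → ℝ) → Ξ → Finset (Fin m)
  measurable_run : ∀ S, MeasurableSet {p : (Fin m → ℝ) × Ξ | run p.1 p.2 = S}
  run_mem : ∀ ν ∈ cube m, ∀ ξ, run ν ξ ∈ M.superArms
  approx : ∀ ν ∈ cube m,
    ENNReal.ofReal β ≤ seedLaw {ξ | α * M.opt ν ≤ M.reward ν (run ν ξ)}

attribute [instance] Oracle.isProbabilityMeasure_seedLaw

/-- A rule for the rounds in which the algorithm is allowed to play an arbitrary super arm; the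
choice may depend on the round, on the current upper confidence bounds and on the seed. -/
structure FreeRule (Ξ : Type*) [MeasurableSpace Ξ] where
  run : ℕ → (Fin m → ℝ) → Ξ → Finset (Fin m)
  measurable_run : ∀ t S, MeasurableSet {p : (Fin m → ℝ) × Ξ | run t p.1 p.2 = S}
  run_mem : ∀ t ν ξ, run t ν ξ ∈ M.superArms

end SemiBandit

/-! ### The tree-based aggregation scheme -/

/-- The standard Laplace distribution `Lap(1)`; if `Z` has this law then `b * Z` has the law
`Lap(b)`. -/
noncomputable def stdLaplace : Measure ℝ :=
  volume.withDensity fun x => ENNReal.ofReal (Real.exp (-|x|) / 2)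

instance isProbabilityMeasure_stdLaplace : IsProbabilityMeasure stdLaplace := by
  have h : ∫ x : ℝ, Real.exp (-|x|) / 2 = 1 := by
    rw [integral_comp_abs (f := fun x => Real.exp (-x) / 2), integral_div,
      integral_exp_neg_Ioi_zero]
    norm_num
  refine ⟨?_⟩
  rw [stdLaplace, withDensity_apply _ MeasurableSet.univ, Measure.restrict_univ,
    ← ofReal_integral_eq_lintegral_ofReal (integrable_of_integral_eq_one h)
      (Filter.Eventually.of_forall fun x => by positivity), h, ENNReal.ofReal_one]

/-- The steps covered by the tree node `(ℓ, q)` (with `q ≥ 1`), the `q`-th node of level `ℓ`: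
`(q-1) 2^ℓ + 1, …, q 2^ℓ`. -/
def nodeSteps (ℓ q : ℕ) : Finset ℕ := Finset.Ioc ((q - 1) * 2 ^ ℓ) (q * 2 ^ ℓ)

/-- The levels of the nodes `(ℓ, ⌊t / 2^ℓ⌋)` into which `{1, …, t}` is split: one node for every
binary digit `1` of `t`. -/
def prefixLevels (t : ℕ) : Finset ℕ := (Finset.range (t + 1)).filter fun ℓ => t.testBit ℓ

/-- The steps `1, …, t` are the disjoint union of the steps of the nodes used for `t`. -/
theorem sum_prefixLevels (t : ℕ) (f : ℕ → ℝ) :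
    ∑ ℓ ∈ prefixLevels t, ∑ τ ∈ nodeSteps ℓ (t / 2 ^ ℓ), f τ = ∑ τ ∈ Finset.Icc 1 t, f τ := by
  have key : ∀ n : ℕ,
      ∑ ℓ ∈ (Finset.range n).filter (fun ℓ => t.testBit ℓ),
          ∑ τ ∈ nodeSteps ℓ (t / 2 ^ ℓ), f τ
        + ∑ τ ∈ Finset.Ioc 0 (t / 2 ^ n * 2 ^ n), f τ = ∑ τ ∈ Finset.Ioc 0 t, f τ := by
    intro n
    induction n with
    | zero => simp
    | succ n ih =>
      rw [← ih, Finset.range_add_one, Finset.filter_insert]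
      have hdiv : t / 2 ^ (n + 1) = t / 2 ^ n / 2 := by
        rw [pow_succ, Nat.div_div_eq_div_mul]
      have hbit : t.testBit n = decide (t / 2 ^ n % 2 = 1) := Nat.testBit_eq_decide_div_mod_eq
      have hp : 2 ^ (n + 1) = 2 * 2 ^ n := by ring
      by_cases hb : t / 2 ^ n % 2 = 1
      · have e : t / 2 ^ (n + 1) * 2 ^ (n + 1) = (t / 2 ^ n - 1) * 2 ^ n := by
          have : t / 2 ^ n - 1 = t / 2 ^ n / 2 * 2 := by omega
          rw [hdiv, hp, this]; ring
        have hle : (t / 2 ^ n - 1) * 2 ^ n ≤ t / 2 ^ n * 2 ^ n :=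
          Nat.mul_le_mul_right _ (Nat.sub_le _ _)
        rw [if_pos (by simp [hbit, hb]), Finset.sum_insert (by simp), e,
          ← Finset.sum_Ioc_consecutive f (Nat.zero_le _) hle, nodeSteps]
        ring
      · have e : t / 2 ^ (n + 1) * 2 ^ (n + 1) = t / 2 ^ n * 2 ^ n := by
          have : t / 2 ^ n = t / 2 ^ n / 2 * 2 := by omega
          rw [hdiv, hp]
          conv_rhs => rw [this]
          ring
        rw [if_neg (by simp [hbit, hb]), e]
  have h := key (t + 1)
  have h0 : t / 2 ^ (t + 1) = 0 :=
    Nat.div_eq_of_lt (lt_trans (Nat.lt_succ_self t) Nat.lt_two_pow_self)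
  rw [h0] at h
  have hI : Finset.Icc 1 t = Finset.Ioc 0 t := by ext; simp [Nat.succ_le_iff]
  rw [hI, ← h]
  simp [prefixLevels]

/-- The output of the tree for the stream `leaf 1, …, leaf t`: the sum of the noisy values of
the nodes used for `t`. The node `(ℓ, q)` stores the sum of its leaves plus
its own noise `b * noise (ℓ, q)`. -/
noncomputable def treeAggregate (b : ℝ) (noise : ℕ × ℕ → ℝ) (leaf : ℕ → ℝ) (t : ℕ) : ℝ :=
  ∑ ℓ ∈ prefixLevels t,
    (∑ τ ∈ nodeSteps ℓ (t / 2 ^ ℓ), leaf τ + b * noise (ℓ, t / 2 ^ ℓ))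

/-! ### The algorithm CUCB-DP -/

/-- The state of the algorithm after some number of rounds. -/
structure State (m : ℕ) where
  /-- `T_{t,i}`, the number of rounds in which `i` has been played -/
  count : Fin m → ℕ
  /-- the leaves of the tree: `leaf τ i` is `X_{τ,i}` if `i` was played in round `τ`,
  and `0` otherwise -/
  leaf : ℕ → Fin m → ℝ
  /-- the noisy estimates of the means -/
  est : Fin m → ℝ

/-- The initial state. -/
def State.init (m : ℕ) : State m := ⟨fun _ => 0, fun _ _ => 0, fun _ => 0⟩

/-- The upper confidence bounds `μ̄(i)`. For a base arm that has not been played the confidence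
radius is infinite, so that the bound is `1`. -/
noncomputable def State.ucb {m : ℕ} (s : State m) (K T : ℕ) (ε : ℝ) (i : Fin m) : ℝ :=
  if s.count i = 0 then 1
  else min (s.est i + √(4 * Real.log (m * T) / s.count i)
    + 12 * K * Real.log T ^ 3 / (s.count i * ε)) 1

/-- The scale `2 K log T / ε` of the Laplace noise in the tree, `log` being the binary
logarithm. -/
noncomputable def noiseScale (K T : ℕ) (ε : ℝ) : ℝ := 2 * K * Real.logb 2 T / ε

open Classical in
/-- The update at the end of round `t` in which `S` was played and the outcome vector was `x`;
only the coordinates `x i` with `i ∈ S` are used. -/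
noncomputable def State.update {m : ℕ} (s : State m) (b : ℝ) (noise : ℕ × ℕ × Fin m → ℝ) (t : ℕ)
    (S : Finset (Fin m)) (x : Fin m → ℝ) : State m :=
  let leaf' : ℕ → Fin m → ℝ := Function.update s.leaf t fun i => if i ∈ S then x i else 0
  let count' : Fin m → ℕ := fun i => if i ∈ S then s.count i + 1 else s.count i
  { count := count'
    leaf := leaf'
    est := fun i =>
      if i ∈ S then
        treeAggregate b (fun n => noise (n.1, n.2, i)) (fun τ => leaf' τ i) t / count' i
      else s.est i }

/-- All the randomness of a run. -/
structure Randomness (m : ℕ) (Ξ : Type*) where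
  outcome : ℕ → Fin m → ℝ
  noise : ℕ × ℕ × Fin m → ℝ
  seed : ℕ → Ξ

namespace SemiBandit

variable {m : ℕ} (M : SemiBandit m) {α β : ℝ} {Ξ : Type*} [MeasurableSpace Ξ]

open Classical in
/-- The super arm played in round `t` when the state before the round is `s`. -/
noncomputable def select (O : M.Oracle α β Ξ) (F : M.FreeRule Ξ) (T : ℕ) (ε : ℝ) (t : ℕ)
    (s : State m) (ξ : Ξ) : Finset (Fin m) :=
  if ∀ i, 0 ≤ s.ucb M.K T ε i then O.run (s.ucb M.K T ε) ξ else F.run t (s.ucb M.K T ε) ξ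

/-- The state of CUCB-DP, with horizon `T` and privacy parameter `ε`, after `t` rounds. -/
noncomputable def state (O : M.Oracle α β Ξ) (F : M.FreeRule Ξ) (T : ℕ) (ε : ℝ)
    (ω : Randomness m Ξ) : ℕ → State m
  | 0 => State.init m
  | t + 1 =>
    let s := state O F T ε ω t
    s.update (noiseScale M.K T ε) ω.noise (t + 1)
      (M.select O F T ε (t + 1) s (ω.seed (t + 1))) (ω.outcome (t + 1))

/-- The super arm that CUCB-DP plays in round `t + 1`. -/
noncomputable def played (O : M.Oracle α β Ξ) (F : M.FreeRule Ξ) (T : ℕ) (ε : ℝ)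
    (ω : Randomness m Ξ) (t : ℕ) : Finset (Fin m) :=
  M.select O F T ε (t + 1) (M.state O F T ε ω t) (ω.seed (t + 1))

/-- The law of the randomness: all outcome vectors, all noise variables and all seeds are
independent, with laws `M.law`, `Lap(1)` and `O.seedLaw`. -/
noncomputable def randomLaw (O : M.Oracle α β Ξ) :
    Measure ((ℕ → Fin m → ℝ) × (ℕ × ℕ × Fin m → ℝ) × (ℕ → Ξ)) :=
  (Measure.infinitePi fun _ : ℕ => M.law).prod
    ((Measure.infinitePi fun _ : ℕ × ℕ × Fin m => stdLaplace).prod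
      (Measure.infinitePi fun _ : ℕ => O.seedLaw))

/-- The `(α,β)`-approximation regret of CUCB-DP over `T` rounds:
`T α β r_μ(S*) - E[∑_t r_μ(S_t)]`. -/
noncomputable def regret (O : M.Oracle α β Ξ) (F : M.FreeRule Ξ) (T : ℕ) (ε : ℝ) : ℝ :=
  T * (α * β * M.opt M.mean)
    - ∫ ω, ∑ t ∈ Finset.range T, M.reward M.mean (M.played O F T ε ⟨ω.1, ω.2.1, ω.2.2⟩ t)
        ∂M.randomLaw O

/-- The gap-dependent term `∑_{i : Δ^i_min > 0} K B₁² ln² T / Δ^i_min`. -/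
noncomputable def gapTerm (α B₁ : ℝ) (T : ℕ) : ℝ :=
  ∑ i : Fin m with 0 < M.gapMin α i, M.K * B₁ ^ 2 * Real.log T ^ 2 / M.gapMin α i

end SemiBandit

end DPCSB

namespace DPCSB

/-! ### Resampling one coordinate of a product measure -/

/-! The proof is an optimism argument on a good event, followed by an accounting that charges each
gap to the play counts of the base arms.

Good event. The estimation error of an arm played `n` times is a martingale sum plus tree noise. The
first is controlled by an exponential supermartingale (`lintegral_exp_deviation_le`), the second by
a Chernoff bound over the at most `log₂ (2t)` nodes in use (`measureReal_noise_ge_le`). A union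
bound makes all confidence intervals valid in a given round except with probability `18 m / T`
(`measureReal_not_isGood_le`), which costs `O(m Δ_max)` over `T` rounds. Conditioning on the past is
done by resampling a single coordinate of the product measure.

Optimism. If the bounds are valid and the oracle succeeds, monotonicity and smoothness bound the gap
played by `B₁` times the sum of the confidence widths. The seed is fresh, so success has conditional
probability at least `β`, and the factor `β` in the regret pays for the failures
(`integral_sub_reward_le`).

Charging. The widths are `√(q/n) + c/n`. `le_sum_charge` distributes the gap among the arms of `S`
so that each arm pays an amount depending only on its own count; as the count rises with every play,
each value is paid once. The square root part sums to `O(K B₁² ln² T / δ)`, where `δ` is `Δ^i_min`.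
The privacy part contributes only in the window `B c / D < n ≤ 4 B c K / δ` with `D = Δ_max`, hence
`B c (1 + ln (4 K D / δ))`. To remove `δ` from this logarithm, split off the factor `ε B / (δ ln T)`
and use `ln y ≤ y`: multiplied by the privacy coefficient it becomes another gap term
(`sum_charge_le_posLog`). -/

theorem lintegral_infinitePi_update {ι : Type*} [DecidableEq ι] {X : ι → Type*}
    [∀ i, MeasurableSpace (X i)] (μ : ∀ i, Measure (X i)) [∀ i, IsProbabilityMeasure (μ i)] (j : ι)
    {f : (∀ i, X i) → ENNReal} (hf : Measurable f) :
    ∫⁻ x, f x ∂Measure.infinitePi μ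
      = ∫⁻ x, ∫⁻ y, f (Function.update x j y) ∂μ j ∂Measure.infinitePi μ := by
  have hu : Measurable fun p : (∀ i, X i) × X j => Function.update p.1 j p.2 := by
    refine measurable_pi_lambda _ fun i => ?_
    by_cases h : i = j
    · subst h
      simpa using measurable_snd
    · simp only [Function.update_of_ne h]
      fun_prop
  have hmap : ((Measure.infinitePi μ).prod (μ j)).map
      (fun p => Function.update p.1 j p.2) = Measure.infinitePi μ := by
    -- It suffices to test on finite boxes; the preimage of a box constrains the old point off `j`
    -- and the new value at `j`.
    refine Measure.eq_infinitePi _ fun s t ht => ?_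
    rw [Measure.map_apply hu (MeasurableSet.pi s.countable_toSet fun i _ => ht i)]
    have hpre : (fun p : (∀ i, X i) × X j => Function.update p.1 j p.2) ⁻¹' Set.pi s t
        = Set.pi (s.erase j : Finset ι) t ×ˢ (if j ∈ s then t j else Set.univ) := by
      ext p
      simp only [Set.mem_preimage, Set.mem_pi, Finset.mem_coe, Set.mem_prod, Finset.mem_erase]
      constructor
      · intro h
        refine ⟨fun i hi => by simpa [hi.1] using h i hi.2, ?_⟩
        split_ifs with hj
        · simpa using h j hj
        · trivial
      · rintro ⟨h1, h2⟩ i hi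
        by_cases hij : i = j
        · subst hij
          simpa [hi] using h2
        · simpa [hij] using h1 i ⟨hij, hi⟩
    rw [hpre, Measure.prod_prod, Measure.infinitePi_pi _ fun i _ => ht i]
    split_ifs with hj
    · rw [mul_comm, Finset.mul_prod_erase s (fun i => μ i (t i)) hj]
    · rw [Finset.erase_eq_of_notMem hj, measure_univ, mul_one]
  conv_lhs => rw [← hmap]
  rw [lintegral_map hf hu]
  exact lintegral_prod _ (hf.comp hu).aemeasurable

/-- The sample space of a run of the algorithm. -/
abbrev Sample (m : ℕ) (Ξ : Type*) :=
  (ℕ → Fin m → ℝ) × (ℕ × ℕ × Fin m → ℝ) × (ℕ → Ξ)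

/-- A point of the sample space, seen as the randomness of a run. -/
abbrev Sample.rand {m : ℕ} {Ξ : Type*} (ω : Sample m Ξ) : Randomness m Ξ :=
  ⟨ω.1, ω.2.1, ω.2.2⟩

namespace SemiBandit

variable {m : ℕ} (M : SemiBandit m) {α β : ℝ} {Ξ : Type*} [MeasurableSpace Ξ]

instance (O : M.Oracle α β Ξ) : IsProbabilityMeasure (M.randomLaw O) := by
  unfold randomLaw; infer_instance

theorem lintegral_update_outcome (O : M.Oracle α β Ξ) (j : ℕ) {f : Sample m Ξ → ENNReal}
    (hf : Measurable f) :
    ∫⁻ ω, f ω ∂M.randomLaw O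
      = ∫⁻ ω, ∫⁻ x, f (Function.update ω.1 j x, ω.2) ∂M.law ∂M.randomLaw O := by
  have hg : Measurable fun p : Sample m Ξ × (Fin m → ℝ) =>
      f (Function.update p.1.1 j p.2, p.1.2) := by
    refine hf.comp (Measurable.prodMk (measurable_pi_lambda _ fun i => ?_) (by fun_prop))
    by_cases h : i = j
    · subst h
      simpa using measurable_snd
    · simp only [Function.update_of_ne h]
      fun_prop
  have hg' : Measurable fun ω : Sample m Ξ =>
      ∫⁻ x, f (Function.update ω.1 j x, ω.2) ∂M.law := hg.lintegral_prod_right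
  unfold randomLaw
  rw [lintegral_prod_symm _ hf.aemeasurable, lintegral_prod_symm _ hg'.aemeasurable]
  refine lintegral_congr fun y => ?_
  exact lintegral_infinitePi_update (fun _ => M.law) j (f := fun x => f (x, y)) (by fun_prop)

theorem lintegral_update_seed (O : M.Oracle α β Ξ) (j : ℕ) {f : Sample m Ξ → ENNReal}
    (hf : Measurable f) :
    ∫⁻ ω, f ω ∂M.randomLaw O
      = ∫⁻ ω, ∫⁻ ξ, f (ω.1, ω.2.1, Function.update ω.2.2 j ξ) ∂O.seedLaw ∂M.randomLaw O := by
  have hg : Measurable fun p : Sample m Ξ × Ξ =>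
      f (p.1.1, p.1.2.1, Function.update p.1.2.2 j p.2) := by
    refine hf.comp (Measurable.prodMk (by fun_prop) (Measurable.prodMk (by fun_prop)
      (measurable_pi_lambda _ fun i => ?_)))
    by_cases h : i = j
    · subst h
      simpa using measurable_snd
    · simp only [Function.update_of_ne h]
      fun_prop
  have hg' : Measurable fun ω : Sample m Ξ =>
      ∫⁻ ξ, f (ω.1, ω.2.1, Function.update ω.2.2 j ξ) ∂O.seedLaw := hg.lintegral_prod_right
  unfold randomLaw
  rw [lintegral_prod _ hf.aemeasurable, lintegral_prod _ hg'.aemeasurable]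
  refine lintegral_congr fun x => ?_
  rw [lintegral_prod _ (by fun_prop), lintegral_prod _ (by fun_prop)]
  refine lintegral_congr fun y => ?_
  exact lintegral_infinitePi_update (fun _ => O.seedLaw) j (f := fun z => f (x, y, z))
    (by fun_prop)

/-! ### The state depends on the past only, and is measurable -/

/-- The outcome and seed of round `t + 1` carry the index `t + 1`, so resampling either leaves the
state after `t` rounds unchanged. This plays the role of adaptedness to a filtration. The noise is
kept fixed as a whole. -/
theorem state_congr (O : M.Oracle α β Ξ) (F : M.FreeRule Ξ) (T : ℕ) (ε : ℝ)
    {ω ω' : Randomness m Ξ} (hn : ω.noise = ω'.noise) (t : ℕ)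
    (ho : ∀ τ ≤ t, ω.outcome τ = ω'.outcome τ) (hs : ∀ τ ≤ t, ω.seed τ = ω'.seed τ) :
    M.state O F T ε ω t = M.state O F T ε ω' t := by
  induction t with
  | zero => rfl
  | succ t ih =>
    simp only [state]
    rw [ih (fun τ h => ho τ (by omega)) (fun τ h => hs τ (by omega)), hn, ho _ le_rfl,
      hs _ le_rfl]

theorem state_update_outcome (O : M.Oracle α β Ξ) (F : M.FreeRule Ξ) (T : ℕ) (ε : ℝ)
    (ω : Sample m Ξ) (t : ℕ) (x : Fin m → ℝ) :
    M.state O F T ε (Sample.rand (Function.update ω.1 (t + 1) x, ω.2)) t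
      = M.state O F T ε ω.rand t :=
  M.state_congr O F T ε (ω := Sample.rand (Function.update ω.1 (t + 1) x, ω.2)) (ω' := ω.rand) rfl t
    (fun τ h => Function.update_of_ne (by omega) _ _) fun _ _ => rfl

theorem state_update_seed (O : M.Oracle α β Ξ) (F : M.FreeRule Ξ) (T : ℕ) (ε : ℝ)
    (ω : Sample m Ξ) (t : ℕ) (ξ : Ξ) :
    M.state O F T ε (Sample.rand (ω.1, ω.2.1, Function.update ω.2.2 (t + 1) ξ)) t
      = M.state O F T ε ω.rand t :=
  M.state_congr O F T ε (ω := Sample.rand (ω.1, ω.2.1, Function.update ω.2.2 (t + 1) ξ))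
    (ω' := ω.rand) rfl t (fun _ _ => rfl) fun τ h => Function.update_of_ne (by omega) _ _

theorem played_update_outcome (O : M.Oracle α β Ξ) (F : M.FreeRule Ξ) (T : ℕ) (ε : ℝ)
    (ω : Sample m Ξ) (t : ℕ) (x : Fin m → ℝ) :
    M.played O F T ε (Sample.rand (Function.update ω.1 (t + 1) x, ω.2)) t
      = M.played O F T ε ω.rand t := by
  simp only [played, state_update_outcome]

theorem played_update_seed (O : M.Oracle α β Ξ) (F : M.FreeRule Ξ) (T : ℕ) (ε : ℝ)
    (ω : Sample m Ξ) (t : ℕ) (ξ : Ξ) :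
    M.played O F T ε (Sample.rand (ω.1, ω.2.1, Function.update ω.2.2 (t + 1) ξ)) t
      = M.select O F T ε (t + 1) (M.state O F T ε ω.rand t) ξ := by
  simp only [played, state_update_seed, Function.update_self]

theorem state_succ_count (O : M.Oracle α β Ξ) (F : M.FreeRule Ξ) (T : ℕ) (ε : ℝ)
    (ω : Randomness m Ξ) (t : ℕ) (i : Fin m) :
    (M.state O F T ε ω (t + 1)).count i
      = (M.state O F T ε ω t).count i + if i ∈ M.played O F T ε ω t then 1 else 0 := by
  by_cases h : i ∈ M.played O F T ε ω t
  · rw [if_pos h]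
    exact if_pos h
  · rw [if_neg h]
    exact if_neg h

theorem count_le (O : M.Oracle α β Ξ) (F : M.FreeRule Ξ) (T : ℕ) (ε : ℝ)
    (ω : Randomness m Ξ) (t : ℕ) (i : Fin m) : (M.state O F T ε ω t).count i ≤ t := by
  induction t with
  | zero => simp [state, State.init]
  | succ t ih =>
    rw [state_succ_count]
    split_ifs <;> omega

theorem ucb_le_one {m : ℕ} (s : State m) (K T : ℕ) (ε : ℝ) (i : Fin m) : s.ucb K T ε i ≤ 1 := by
  unfold State.ucb
  split_ifs
  · exact le_rfl
  · exact min_le_right _ _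

theorem select_mem (O : M.Oracle α β Ξ) (F : M.FreeRule Ξ) (T : ℕ) (ε : ℝ) (t : ℕ)
    (s : State m) (ξ : Ξ) : M.select O F T ε t s ξ ∈ M.superArms := by
  unfold select
  split_ifs with h
  · exact O.run_mem _ (fun i => ⟨h i, ucb_le_one s _ _ _ i⟩) ξ
  · exact F.run_mem _ _ _

theorem played_mem (O : M.Oracle α β Ξ) (F : M.FreeRule Ξ) (T : ℕ) (ε : ℝ)
    (ω : Randomness m Ξ) (t : ℕ) : M.played O F T ε ω t ∈ M.superArms :=
  M.select_mem O F T ε _ _ _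

/-- Measurability of a random state, in terms of its components. -/
structure MeasurableState {Ω : Type*} [MeasurableSpace Ω] (s : Ω → State m) : Prop where
  count : Measurable fun ω => (s ω).count
  leaf : ∀ τ, Measurable fun ω => (s ω).leaf τ
  est : Measurable fun ω => (s ω).est

theorem MeasurableState.ucb {Ω : Type*} [MeasurableSpace Ω] {s : Ω → State m}
    (hs : MeasurableState s) (K T : ℕ) (ε : ℝ) : Measurable fun ω => (s ω).ucb K T ε := by
  refine measurable_pi_lambda _ fun i => ?_
  have hc : Measurable fun ω => (s ω).count i := (measurable_pi_apply i).comp hs.count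
  have he : Measurable fun ω => (s ω).est i := (measurable_pi_apply i).comp hs.est
  unfold State.ucb
  refine Measurable.ite (hc (measurableSet_singleton 0)) measurable_const ?_
  have hr : Measurable fun n : ℕ =>
      √(4 * Real.log (m * T) / n) + 12 * K * Real.log T ^ 3 / (n * ε) := Measurable.of_discrete
  have := hr.comp hc
  simp only [Function.comp_def] at this
  simp only [add_assoc]
  exact (he.add this).min measurable_const

theorem MeasurableState.select {Ω : Type*} [MeasurableSpace Ω] {s : Ω → State m}
    (hs : MeasurableState s) (O : M.Oracle α β Ξ) (F : M.FreeRule Ξ) (T : ℕ) (ε : ℝ) (t : ℕ)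
    {ξ : Ω → Ξ} (hξ : Measurable ξ) :
    Measurable fun ω => M.select O F T ε t (s ω) (ξ ω) := by
  have hu := hs.ucb M.K T ε
  have hp := hu.prodMk hξ
  unfold SemiBandit.select
  refine Measurable.ite ?_ (measurable_to_countable' fun S => hp (O.measurable_run S))
    (measurable_to_countable' fun S => hp (F.measurable_run t S))
  simp only [Set.ofPred_forall]
  exact MeasurableSet.iInter fun i =>
    measurableSet_le measurable_const ((measurable_pi_apply i).comp hu)

theorem measurableState_state (O : M.Oracle α β Ξ) (F : M.FreeRule Ξ) (T : ℕ) (ε : ℝ) (t : ℕ) :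
    MeasurableState fun ω : Sample m Ξ => M.state O F T ε ω.rand t := by
  induction t with
  | zero => exact ⟨measurable_const, fun _ => measurable_const, measurable_const⟩
  | succ t ih =>
    have hS : Measurable fun ω : Sample m Ξ =>
        M.select O F T ε (t + 1) (M.state O F T ε ω.rand t) (ω.2.2 (t + 1)) :=
      ih.select M O F T ε (t + 1) (by fun_prop)
    have hmem : ∀ i, MeasurableSet {ω : Sample m Ξ |
        i ∈ M.select O F T ε (t + 1) (M.state O F T ε ω.rand t) (ω.2.2 (t + 1))} :=
      fun i => hS (measurableSet_mem_finset i)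
    have hcount : Measurable fun ω : Sample m Ξ => (M.state O F T ε ω.rand (t + 1)).count := by
      refine measurable_pi_lambda _ fun i => ?_
      have hc : Measurable fun ω : Sample m Ξ => (M.state O F T ε ω.rand t).count i :=
        (measurable_pi_apply i).comp ih.count
      exact Measurable.ite (hmem i) (hc.add_const 1) hc
    have hleaf : ∀ τ, Measurable fun ω : Sample m Ξ =>
        (M.state O F T ε ω.rand (t + 1)).leaf τ := by
      intro τ
      by_cases h : τ = t + 1
      · subst h
        simp only [state, State.update, Function.update_self]
        refine measurable_pi_lambda _ fun i => ?_
        exact Measurable.ite (hmem i) (by fun_prop) measurable_const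
      · simp only [state, State.update, Function.update_of_ne h]
        exact ih.leaf τ
    refine ⟨hcount, hleaf, measurable_pi_lambda _ fun i => ?_⟩
    refine Measurable.ite (hmem i) ?_ ((measurable_pi_apply i).comp ih.est)
    have h1 : Measurable fun ω : Sample m Ξ => treeAggregate (noiseScale M.K T ε)
        (fun n => ω.2.1 (n.1, n.2, i))
        (fun τ => (M.state O F T ε ω.rand (t + 1)).leaf τ i) (t + 1) := by
      unfold treeAggregate
      refine Finset.measurable_sum _ fun ℓ _ => Measurable.add ?_ (by fun_prop)
      exact Finset.measurable_sum _ fun τ _ => (measurable_pi_apply i).comp (hleaf τ)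
    have h2 : Measurable fun ω : Sample m Ξ =>
        ((M.state O F T ε ω.rand (t + 1)).count i : ℝ) :=
      measurable_from_nat.comp ((measurable_pi_apply i).comp hcount)
    exact h1.div h2

theorem measurable_played (O : M.Oracle α β Ξ) (F : M.FreeRule Ξ) (T : ℕ) (ε : ℝ) (t : ℕ) :
    Measurable fun ω : Sample m Ξ => M.played O F T ε ω.rand t :=
  (M.measurableState_state O F T ε t).select M O F T ε (t + 1) (by fun_prop)

theorem measurable_count (O : M.Oracle α β Ξ) (F : M.FreeRule Ξ) (T : ℕ) (ε : ℝ) (t : ℕ)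
    (i : Fin m) : Measurable fun ω : Sample m Ξ => (M.state O F T ε ω.rand t).count i :=
  (measurable_pi_apply i).comp (M.measurableState_state O F T ε t).count

theorem measurable_ucb (O : M.Oracle α β Ξ) (F : M.FreeRule Ξ) (T : ℕ) (ε : ℝ) (t : ℕ)
    (i : Fin m) :
    Measurable fun ω : Sample m Ξ => (M.state O F T ε ω.rand t).ucb M.K T ε i :=
  (measurable_pi_apply i).comp ((M.measurableState_state O F T ε t).ucb M.K T ε)

end SemiBandit
end DPCSB

namespace DPCSB

/-! ### The tail of the noise of the tree -/

/-- The exponent `1/2` gives the moment `1 / (1 - 1/2) = 2`, so that a sum over `k` nodes has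
exponential moment `2 ^ k`, which is linear in `t`. -/
theorem integrable_exp_abs_stdLaplace :
    Integrable (fun x : ℝ => Real.exp (1 / 2 * |x|)) stdLaplace ∧
      ProbabilityTheory.mgf (fun x : ℝ => |x|) stdLaplace (1 / 2) = 2 := by
  have hd : Measurable fun x : ℝ => ENNReal.ofReal (Real.exp (-|x|) / 2) := by fun_prop
  have hfun : (fun x : ℝ => (ENNReal.ofReal (Real.exp (-|x|) / 2)).toReal •
      Real.exp (1 / 2 * |x|)) = fun x => Real.exp (-(1 / 2) * |x|) / 2 := by
    funext x
    rw [ENNReal.toReal_ofReal (by positivity), smul_eq_mul, div_mul_eq_mul_div, ← Real.exp_add]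
    ring_nf
  have hint : ∫ x : ℝ, Real.exp (-(1 / 2) * |x|) / 2 = 2 := by
    rw [integral_comp_abs (f := fun x => Real.exp (-(1 / 2) * x) / 2), integral_div,
      integral_exp_mul_Ioi (by norm_num)]
    norm_num
  constructor
  · rw [stdLaplace, integrable_withDensity_iff_integrable_smul' hd (by simp), hfun]
    exact Integrable.of_integral_ne_zero (by rw [hint]; norm_num)
  · rw [ProbabilityTheory.mgf, stdLaplace, integral_withDensity_eq_integral_toReal_smul hd
      (by simp), hfun, hint]

theorem two_pow_card_prefixLevels_le {t : ℕ} (ht : t ≠ 0) :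
    2 ^ (prefixLevels t).card ≤ 2 * t := by
  have hsub : prefixLevels t ⊆ Finset.range (Nat.log 2 t + 1) := by
    intro ℓ hℓ
    simp only [prefixLevels, Finset.mem_filter, Finset.mem_range] at hℓ ⊢
    exact Nat.lt_succ_of_le (Nat.le_log_of_pow_le (by norm_num) (Nat.ge_two_pow_of_testBit hℓ.2))
  have hcard := Finset.card_le_card hsub
  rw [Finset.card_range] at hcard
  calc 2 ^ (prefixLevels t).card ≤ 2 ^ (Nat.log 2 t + 1) := Nat.pow_le_pow_right (by norm_num) hcard
    _ = 2 * 2 ^ Nat.log 2 t := by ring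
    _ ≤ 2 * t := Nat.mul_le_mul_left _ (Nat.pow_log_le_self 2 ht)

namespace SemiBandit

variable {m : ℕ} (M : SemiBandit m) {α β : ℝ} {Ξ : Type*} [MeasurableSpace Ξ]

theorem measureReal_noise_ge_le (O : M.Oracle α β Ξ) {t : ℕ} (ht : t ≠ 0) (i : Fin m) (s : ℝ) :
    (M.randomLaw O).real {ω | s ≤ ∑ ℓ ∈ prefixLevels t, |ω.2.1 (ℓ, t / 2 ^ ℓ, i)|}
      ≤ Real.exp (-(1 / 2) * s) * (2 * t) := by
  set N : Measure (ℕ × ℕ × Fin m → ℝ) := Measure.infinitePi fun _ => stdLaplace with hN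
  have hmp : MeasurePreserving (fun ω : Sample m Ξ => ω.2.1) (M.randomLaw O) N :=
    measurePreserving_fst.comp measurePreserving_snd
  -- Different levels use different nodes, so the noises in the sum are independent.
  set e : ℕ ↪ ℕ × ℕ × Fin m := ⟨fun ℓ => (ℓ, t / 2 ^ ℓ, i), fun a b h => by simpa using
    (Prod.ext_iff.1 h).1⟩ with he
  set X : (ℕ × ℕ × Fin m) → (ℕ × ℕ × Fin m → ℝ) → ℝ := fun n z => |z n| with hX
  have hXm : ∀ n, Measurable (X n) := fun n => by simp only [hX]; fun_prop
  have hind : ProbabilityTheory.iIndepFun X N :=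
    ProbabilityTheory.iIndepFun_infinitePi (P := fun _ : ℕ × ℕ × Fin m => stdLaplace)
      (X := fun _ x => |x|) fun _ => by fun_prop
  have hev : ∀ n, MeasurePreserving (fun z : ℕ × ℕ × Fin m → ℝ => z n) N stdLaplace :=
    fun n => measurePreserving_eval_infinitePi _ n
  have hmgf : ∀ n, ProbabilityTheory.mgf (X n) N (1 / 2) = 2 := by
    intro n
    have h := integrable_exp_abs_stdLaplace.2
    rw [← (hev n).map_eq, ProbabilityTheory.mgf_map (hev n).measurable.aemeasurable
      (by fun_prop)] at h
    exact h
  have hintg : ∀ n, Integrable (fun z => Real.exp (1 / 2 * X n z)) N := fun n =>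
    (hev n).integrable_comp_of_integrable integrable_exp_abs_stdLaplace.1
  have hset : {ω : Sample m Ξ | s ≤ ∑ ℓ ∈ prefixLevels t, |ω.2.1 (ℓ, t / 2 ^ ℓ, i)|}
      = (fun ω : Sample m Ξ => ω.2.1) ⁻¹' {z | s ≤ (∑ n ∈ (prefixLevels t).map e, X n) z} := by
    ext ω
    simp only [Set.mem_ofPred_eq, Set.mem_preimage, Finset.sum_apply, Finset.sum_map, hX]
    rfl
  have hS : Measurable (∑ n ∈ (prefixLevels t).map e, X n) := by
    rw [show (∑ n ∈ (prefixLevels t).map e, X n) = fun z => ∑ n ∈ (prefixLevels t).map e, X n z from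
      funext fun z => Finset.sum_apply _ _ _]
    exact Finset.measurable_sum _ fun n _ => hXm n
  rw [hset, hmp.measureReal_preimage (measurableSet_le measurable_const hS).nullMeasurableSet]
  refine (ProbabilityTheory.measure_ge_le_exp_mul_mgf s (t := 1 / 2) (by norm_num)
    (hind.integrable_exp_mul_sum hXm fun n _ => hintg n)).trans ?_
  rw [hind.mgf_sum hXm, Finset.prod_congr rfl fun n _ => hmgf n, Finset.prod_const,
    Finset.card_map]
  gcongr
  exact_mod_cast two_pow_card_prefixLevels_le ht

/-! ### The deviation of the sums of observed outcomes -/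

open Classical in
/-- The sum of the centred outcomes of the base arm `i` observed in the first `t` rounds. -/
noncomputable def deviation (O : M.Oracle α β Ξ) (F : M.FreeRule Ξ) (T : ℕ) (ε : ℝ)
    (ω : Randomness m Ξ) (i : Fin m) (t : ℕ) : ℝ :=
  ∑ τ ∈ Finset.range t,
    if i ∈ M.played O F T ε ω τ then ω.outcome (τ + 1) i - M.mean i else 0

theorem mean_mem (i : Fin m) : 0 ≤ M.mean i ∧ M.mean i ≤ 1 := by
  constructor
  · exact integral_nonneg_of_ae (M.law_cube.mono fun x hx => (hx i).1)
  · have h : Integrable (fun x : Fin m → ℝ => x i) M.law :=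
      Integrable.of_mem_Icc 0 1 (measurable_pi_apply i).aemeasurable (M.law_cube.mono fun x hx => hx i)
    calc M.mean i ≤ ∫ _, (1 : ℝ) ∂M.law :=
          integral_mono_ae h (integrable_const _) (M.law_cube.mono fun x hx => (hx i).2)
      _ = 1 := by simp

/-- Hoeffding's lemma: a variable in `[0,1]` is sub-Gaussian with variance proxy `1/4`. -/
theorem lintegral_exp_outcome_le (i : Fin m) (l : ℝ) :
    ∫⁻ x, ENNReal.ofReal (Real.exp (l * (x i - M.mean i) - l ^ 2 / 8)) ∂M.law ≤ 1 := by
  have hs := ProbabilityTheory.hasSubgaussianMGF_of_mem_Icc (μ := M.law) (X := fun x => x i)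
    (a := 0) (b := 1) (measurable_pi_apply i).aemeasurable (M.law_cube.mono fun x hx => hx i)
  have h1 : ∀ x : Fin m → ℝ, Real.exp (l * (x i - M.mean i) - l ^ 2 / 8)
      = Real.exp (-(l ^ 2 / 8)) * Real.exp (l * (x i - M.mean i)) := by
    intro x
    rw [← Real.exp_add]
    ring_nf
  have h2 : ∫ x, Real.exp (l * (x i - M.mean i)) ∂M.law ≤ Real.exp (l ^ 2 / 8) := by
    refine (hs.mgf_le l).trans (le_of_eq ?_)
    congr 1
    simp
    ring
  have h3 : Integrable (fun x => Real.exp (l * (x i - M.mean i))) M.law := hs.integrable_exp_mul l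
  simp_rw [h1]
  rw [← ofReal_integral_eq_lintegral_ofReal (h3.const_mul _)
    (Filter.Eventually.of_forall fun x => by positivity), integral_const_mul,
    ← ENNReal.ofReal_one]
  refine ENNReal.ofReal_le_ofReal ?_
  calc _ ≤ Real.exp (-(l ^ 2 / 8)) * Real.exp (l ^ 2 / 8) := by gcongr
    _ = 1 := by rw [← Real.exp_add]; simp

theorem measurable_deviation (O : M.Oracle α β Ξ) (F : M.FreeRule Ξ) (T : ℕ) (ε : ℝ) (i : Fin m)
    (t : ℕ) : Measurable fun ω : Sample m Ξ => M.deviation O F T ε ω.rand i t := by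
  refine Finset.measurable_sum _ fun τ _ => Measurable.ite
    (M.measurable_played O F T ε τ (measurableSet_mem_finset i)) (by fun_prop) measurable_const

/-- Supermartingale property: the choice of round `t + 1` does not depend on that round's outcome,
so integrating this outcome out multiplies by a factor at most `1` if `i` is played, and by `1`
otherwise. -/
theorem lintegral_exp_deviation_le (O : M.Oracle α β Ξ) (F : M.FreeRule Ξ) (T : ℕ) (ε : ℝ)
    (i : Fin m) (l : ℝ) (t : ℕ) :
    ∫⁻ ω : Sample m Ξ, ENNReal.ofReal (Real.exp (l * M.deviation O F T ε ω.rand i t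
      - l ^ 2 / 8 * (M.state O F T ε ω.rand t).count i)) ∂M.randomLaw O ≤ 1 := by
  have hmeas : ∀ t, Measurable fun ω : Sample m Ξ =>
      ENNReal.ofReal (Real.exp (l * M.deviation O F T ε ω.rand i t
        - l ^ 2 / 8 * (M.state O F T ε ω.rand t).count i)) := by
    intro t
    have h1 := M.measurable_deviation O F T ε i t
    have h2 : Measurable fun ω : Sample m Ξ => ((M.state O F T ε ω.rand t).count i : ℝ) :=
      measurable_from_nat.comp (M.measurable_count O F T ε t i)
    exact (((h1.const_mul l).sub (h2.const_mul _)).exp).ennreal_ofReal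
  induction t with
  | zero => simp [deviation, state, State.init]
  | succ t ih =>
    rw [M.lintegral_update_outcome O (t + 1) (hmeas (t + 1))]
    refine (lintegral_mono fun ω : Sample m Ξ => ?_).trans ih
    have hdev : ∀ x, M.deviation O F T ε
        (Sample.rand (Function.update ω.1 (t + 1) x, ω.2)) i t
          = M.deviation O F T ε ω.rand i t := by
      intro x
      refine Finset.sum_congr rfl fun τ hτ => ?_
      have hτ' := Finset.mem_range.1 hτ
      have hst : M.played O F T ε (Sample.rand (Function.update ω.1 (t + 1) x, ω.2)) τ
          = M.played O F T ε ω.rand τ := by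
        unfold played
        rw [M.state_congr O F T ε (ω := Sample.rand (Function.update ω.1 (t + 1) x, ω.2))
          (ω' := ω.rand) rfl τ (fun σ h => Function.update_of_ne (by omega) _ _) fun _ _ => rfl]
      rw [hst]
      simp [Function.update_of_ne (show τ + 1 ≠ t + 1 by omega)]
    have hsucc : ∀ x, M.deviation O F T ε
        (Sample.rand (Function.update ω.1 (t + 1) x, ω.2)) i (t + 1)
          = M.deviation O F T ε ω.rand i t
            + if i ∈ M.played O F T ε ω.rand t then x i - M.mean i else 0 := by
      intro x
      rw [← hdev x, deviation, Finset.sum_range_succ, ← deviation, played_update_outcome]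
      by_cases h : i ∈ M.played O F T ε ω.rand t <;> simp [h]
    simp_rw [state_succ_count, state_update_outcome, played_update_outcome, hsucc]
    by_cases h : i ∈ M.played O F T ε ω.rand t
    · simp only [h, if_true]
      have hsplit : ∀ x : Fin m → ℝ, ENNReal.ofReal (Real.exp
          (l * (M.deviation O F T ε ω.rand i t + (x i - M.mean i))
            - l ^ 2 / 8 * ((M.state O F T ε ω.rand t).count i + 1 : ℕ)))
          = ENNReal.ofReal (Real.exp (l * M.deviation O F T ε ω.rand i t
              - l ^ 2 / 8 * (M.state O F T ε ω.rand t).count i))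
            * ENNReal.ofReal (Real.exp (l * (x i - M.mean i) - l ^ 2 / 8)) := by
        intro x
        rw [← ENNReal.ofReal_mul (by positivity), ← Real.exp_add]
        congr 2
        push_cast
        ring
      simp_rw [hsplit]
      rw [lintegral_const_mul _ (by fun_prop)]
      exact mul_le_of_le_one_right (by simp) (M.lintegral_exp_outcome_le i l)
    · simp [h]

theorem measureReal_deviation_ge_le (O : M.Oracle α β Ξ) (F : M.FreeRule Ξ) (T : ℕ) (ε : ℝ)
    (i : Fin m) (t : ℕ) {n : ℕ} (hn : n ≠ 0) {L : ℝ} (hL : 0 ≤ L) :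
    (M.randomLaw O).real {ω : Sample m Ξ | (M.state O F T ε ω.rand t).count i = n ∧
      √(4 * L * n) ≤ |M.deviation O F T ε ω.rand i t|} ≤ 2 * Real.exp (-(8 * L)) := by
  have hn' : (0 : ℝ) < n := by positivity
  set r : ℝ := √(4 * L / n) with hr
  have hrn : r * n = √(4 * L * n) := by
    rw [hr, show 4 * L * (n : ℝ) = 4 * L / n * n ^ 2 by field_simp,
      Real.sqrt_mul (by positivity), Real.sqrt_sq hn'.le]
  have hr2 : r ^ 2 * n = 4 * L := by
    rw [hr, Real.sq_sqrt (by positivity)]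
    field_simp
  have key : ∀ σ : ℝ, σ ^ 2 = 1 →
      (M.randomLaw O).real {ω : Sample m Ξ | (M.state O F T ε ω.rand t).count i = n ∧
        √(4 * L * n) ≤ σ * M.deviation O F T ε ω.rand i t} ≤ Real.exp (-(8 * L)) := by
    intro σ hσ
    -- On `count = n` the exponent `l r n - l² n / 8` is maximal at `l = 4 r`, with value `2 r² n =
    -- 8 L`; `σ = ±1` selects the tail.
    have h1 := M.lintegral_exp_deviation_le O F T ε i (4 * r * σ) t
    have h2 : ENNReal.ofReal (Real.exp (8 * L)) * (M.randomLaw O)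
        {ω : Sample m Ξ | (M.state O F T ε ω.rand t).count i = n ∧
          √(4 * L * n) ≤ σ * M.deviation O F T ε ω.rand i t} ≤ 1 := by
      refine le_trans ?_ ((mul_meas_ge_le_lintegral₀ ?_ (ENNReal.ofReal (Real.exp (8 * L)))).trans h1)
      · gcongr
        rintro ⟨hc, hd⟩
        refine ENNReal.ofReal_le_ofReal (Real.exp_le_exp.2 ?_)
        rw [hc]
        have h3 : 4 * r * (r * n) ≤ 4 * r * (σ * M.deviation O F T ε (Sample.rand ω) i t) := by
          rw [hrn]
          gcongr
        have h5 : 4 * r * (r * n) = 16 * L := by linear_combination 4 * hr2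
        have h4 : (4 * r * σ) ^ 2 / 8 * (n : ℝ) = 8 * L := by
          linear_combination (2 * r ^ 2 * n) * hσ + 2 * hr2
        rw [h4]
        linarith
      · have h2 : Measurable fun ω : Sample m Ξ => ((M.state O F T ε ω.rand t).count i : ℝ) :=
          measurable_from_nat.comp (M.measurable_count O F T ε t i)
        exact ((((M.measurable_deviation O F T ε i t).const_mul _).sub
          (h2.const_mul _)).exp).ennreal_ofReal.aemeasurable
    have h5 := ENNReal.toReal_mono ENNReal.one_ne_top h2
    rw [ENNReal.toReal_mul, ENNReal.toReal_ofReal (by positivity), ENNReal.toReal_one] at h5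
    rw [Real.exp_neg, ← one_div, le_div_iff₀' (by positivity)]
    exact h5
  calc _ ≤ (M.randomLaw O).real ({ω : Sample m Ξ | (M.state O F T ε ω.rand t).count i = n ∧
          √(4 * L * n) ≤ 1 * M.deviation O F T ε ω.rand i t} ∪
        {ω : Sample m Ξ | (M.state O F T ε ω.rand t).count i = n ∧
          √(4 * L * n) ≤ -1 * M.deviation O F T ε ω.rand i t}) := by
        refine measureReal_mono ?_
        rintro ω ⟨hc, hd⟩
        rcases le_abs.1 hd with h | h
        · exact Or.inl ⟨hc, by linarith⟩
        · exact Or.inr ⟨hc, by linarith⟩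
    _ ≤ _ := (measureReal_union_le _ _).trans (by linarith [key 1 (by norm_num), key (-1) (by norm_num)])

end SemiBandit
end DPCSB

namespace DPCSB
namespace SemiBandit

variable {m : ℕ} (M : SemiBandit m) {α β : ℝ} {Ξ : Type*} [MeasurableSpace Ξ]

/-! ### The good event -/

theorem deviation_succ (O : M.Oracle α β Ξ) (F : M.FreeRule Ξ) (T : ℕ) (ε : ℝ)
    (ω : Randomness m Ξ) (i : Fin m) (t : ℕ) :
    M.deviation O F T ε ω i (t + 1) + (M.state O F T ε ω (t + 1)).count i * M.mean i
      = M.deviation O F T ε ω i t + (M.state O F T ε ω t).count i * M.mean i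
        + if i ∈ M.played O F T ε ω t then ω.outcome (t + 1) i else 0 := by
  rw [state_succ_count, deviation, Finset.sum_range_succ, ← deviation]
  by_cases h : i ∈ M.played O F T ε ω t
  · simp only [h, if_true]
    push_cast
    ring
  · simp [h]

theorem state_succ_leaf (O : M.Oracle α β Ξ) (F : M.FreeRule Ξ) (T : ℕ) (ε : ℝ)
    (ω : Randomness m Ξ) (i : Fin m) (t τ : ℕ) :
    (M.state O F T ε ω (t + 1)).leaf τ i
      = if τ = t + 1 then (if i ∈ M.played O F T ε ω t then ω.outcome (t + 1) i else 0)
        else (M.state O F T ε ω t).leaf τ i := by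
  by_cases h : τ = t + 1
  · subst h
    simp only [state, State.update, Function.update_self, if_true, played]
    congr
  · simp only [state, State.update, Function.update_of_ne h, if_neg h]

theorem sum_leaf (O : M.Oracle α β Ξ) (F : M.FreeRule Ξ) (T : ℕ) (ε : ℝ)
    (ω : Randomness m Ξ) (i : Fin m) (t : ℕ) :
    ∑ τ ∈ Finset.Icc 1 t, (M.state O F T ε ω t).leaf τ i
      = M.deviation O F T ε ω i t + (M.state O F T ε ω t).count i * M.mean i := by
  induction t with
  | zero => simp [deviation, state, State.init]
  | succ t ih =>
    rw [deviation_succ, ← ih, Finset.sum_Icc_succ_top (by omega)]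
    simp only [state_succ_leaf, if_true]
    congr 1
    refine Finset.sum_congr rfl fun τ hτ => if_neg ?_
    have := (Finset.mem_Icc.1 hτ).2
    omega

/-- The witness `τ` is the last round in which `i` was played: since then the estimate, the count
and the deviation are frozen, so the tree noise is that of time `τ`, not `t`. -/
theorem est_mul_count (O : M.Oracle α β Ξ) (F : M.FreeRule Ξ) (T : ℕ) (ε : ℝ)
    (ω : Randomness m Ξ) (i : Fin m) (t : ℕ) (hc : (M.state O F T ε ω t).count i ≠ 0) :
    ∃ τ, τ ≠ 0 ∧ τ ≤ t ∧
      (M.state O F T ε ω t).est i * (M.state O F T ε ω t).count i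
        = M.deviation O F T ε ω i t + (M.state O F T ε ω t).count i * M.mean i
          + noiseScale M.K T ε * ∑ ℓ ∈ prefixLevels τ, ω.noise (ℓ, τ / 2 ^ ℓ, i) := by
  induction t with
  | zero => exact absurd rfl hc
  | succ t ih =>
    by_cases h : i ∈ M.played O F T ε ω t
    · refine ⟨t + 1, by omega, le_rfl, ?_⟩
      have hest : (M.state O F T ε ω (t + 1)).est i
          = treeAggregate (noiseScale M.K T ε) (fun n => ω.noise (n.1, n.2, i))
            (fun τ => (M.state O F T ε ω (t + 1)).leaf τ i) (t + 1)
            / (M.state O F T ε ω (t + 1)).count i := if_pos h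
      rw [hest, div_mul_cancel₀ _ (by exact_mod_cast hc), treeAggregate, Finset.sum_add_distrib,
        sum_prefixLevels, sum_leaf, ← Finset.mul_sum]
    · have hcount : (M.state O F T ε ω (t + 1)).count i = (M.state O F T ε ω t).count i := by
        simp [state_succ_count, h]
      have hest : (M.state O F T ε ω (t + 1)).est i = (M.state O F T ε ω t).est i := if_neg h
      obtain ⟨τ, h0, hτ, he⟩ := ih (hcount ▸ hc)
      refine ⟨τ, h0, by omega, ?_⟩
      rw [deviation_succ, hest, hcount, he]
      simp [h]

/-- The confidence radius of a base arm that has been played `n` times. -/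
noncomputable def radius (T : ℕ) (ε : ℝ) (n : ℕ) : ℝ :=
  √(4 * Real.log (m * T) / n) + 12 * M.K * Real.log T ^ 3 / (n * ε)

/-- The upper confidence bounds are valid and tight. -/
def IsGood (T : ℕ) (ε : ℝ) (s : State m) : Prop :=
  ∀ i, M.mean i ≤ s.ucb M.K T ε i ∧
    (s.count i ≠ 0 → s.ucb M.K T ε i - M.mean i ≤ 2 * M.radius T ε (s.count i))

theorem ucb_bounds {T : ℕ} (hT : 2 ≤ T) {ε : ℝ} (hε : 0 < ε) (O : M.Oracle α β Ξ)
    (F : M.FreeRule Ξ) (ω : Randomness m Ξ) (t : ℕ) (i : Fin m)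
    (hdev : ∀ n ∈ Finset.Icc 1 t, (M.state O F T ε ω t).count i = n →
      |M.deviation O F T ε ω i t| < √(4 * Real.log (m * T) * n))
    (hnoise : ∀ τ ∈ Finset.Icc 1 t,
      ∑ ℓ ∈ prefixLevels τ, |ω.noise (ℓ, τ / 2 ^ ℓ, i)| < 6 * Real.log 2 * Real.log T ^ 2) :
    M.mean i ≤ (M.state O F T ε ω t).ucb M.K T ε i ∧
      ((M.state O F T ε ω t).count i ≠ 0 → (M.state O F T ε ω t).ucb M.K T ε i - M.mean i
        ≤ 2 * M.radius T ε ((M.state O F T ε ω t).count i)) := by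
  have hcle := M.count_le O F T ε ω t i
  by_cases hc : (M.state O F T ε ω t).count i = 0
  · simp [State.ucb, hc, (M.mean_mem i).2]
  obtain ⟨τ, h0, hτ, he⟩ := M.est_mul_count O F T ε ω i t hc
  set n := (M.state O F T ε ω t).count i with hn
  have hn1 : (0 : ℝ) < n := by positivity
  have hd := hdev n (Finset.mem_Icc.2 ⟨by omega, hcle⟩) rfl
  have hz := (Finset.abs_sum_le_sum_abs _ _).trans
    (hnoise τ (Finset.mem_Icc.2 ⟨by omega, hτ⟩)).le
  set z := ∑ ℓ ∈ prefixLevels τ, ω.noise (ℓ, τ / 2 ^ ℓ, i) with hzdef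
  set d := M.deviation O F T ε ω i t with hddef
  set e := (M.state O F T ε ω t).est i with hedef
  have hlT : 0 < Real.log T := Real.log_pos (by exact_mod_cast hT)
  have hl2 : 0 < Real.log 2 := Real.log_pos (by norm_num)
  have hb : 0 ≤ noiseScale M.K T ε := by
    unfold noiseScale Real.logb
    positivity
  have hbz : |noiseScale M.K T ε * z| ≤ 12 * M.K * Real.log T ^ 3 / ε := by
    rw [abs_mul, abs_of_nonneg hb]
    -- The threshold `6 ln 2 ln² T` times the scale `2 K ln T / (ε ln 2)` is exactly the privacy
    -- numerator `12 K ln³ T / ε`.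
    refine (mul_le_mul_of_nonneg_left hz hb).trans (le_of_eq ?_)
    unfold noiseScale Real.logb
    field_simp
    ring
  have hsq : √(4 * Real.log (m * T) * n) = √(4 * Real.log (m * T) / n) * n := by
    rw [show 4 * Real.log (m * T) * (n : ℝ) = 4 * Real.log (m * T) / n * n ^ 2 by field_simp,
      Real.sqrt_mul' _ (by positivity), Real.sqrt_sq hn1.le]
  have hrad : M.radius T ε n * n
      = √(4 * Real.log (m * T) * n) + 12 * M.K * Real.log T ^ 3 / ε := by
    rw [hsq, radius]
    field_simp
  have hdiff : |e - M.mean i| ≤ M.radius T ε n := by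
    refine le_of_mul_le_mul_right ?_ hn1
    rw [hrad, ← abs_of_pos hn1, ← abs_mul, abs_of_pos hn1, sub_mul, he,
      show d + n * M.mean i + noiseScale M.K T ε * z - M.mean i * n = d + noiseScale M.K T ε * z by
        ring]
    exact (abs_add_le _ _).trans (add_le_add hd.le hbz)
  have hucb : (M.state O F T ε ω t).ucb M.K T ε i = min (e + M.radius T ε n) 1 := by
    rw [State.ucb, if_neg hc, radius, ← add_assoc]
  rw [hucb]
  obtain ⟨h1, h2⟩ := abs_le.1 hdiff
  refine ⟨le_min (by linarith) (M.mean_mem i).2, fun _ => ?_⟩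
  linarith [min_le_left (e + M.radius T ε n) 1]

theorem measureReal_not_isGood_le {T : ℕ} (hT : 2 ≤ T) {ε : ℝ} (hε : 0 < ε)
    (O : M.Oracle α β Ξ) (F : M.FreeRule Ξ) {t : ℕ} (ht : t ≤ T) :
    (M.randomLaw O).real {ω : Sample m Ξ | ¬ M.IsGood T ε (M.state O F T ε ω.rand t)}
      ≤ 18 * m / T := by
  have hT0 : (0 : ℝ) < T := by positivity
  set x := Real.log T with hx
  have hTx : (T : ℝ) = Real.exp x := (Real.exp_log hT0).symm
  set A : Fin m → ℕ → Set (Sample m Ξ) := fun i n =>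
    {ω | (M.state O F T ε ω.rand t).count i = n ∧
      √(4 * Real.log (m * T) * n) ≤ |M.deviation O F T ε ω.rand i t|} with hA
  set B : Fin m → ℕ → Set (Sample m Ξ) := fun i τ =>
    {ω | 6 * Real.log 2 * x ^ 2 ≤ ∑ ℓ ∈ prefixLevels τ, |ω.2.1 (ℓ, τ / 2 ^ ℓ, i)|} with hB
  -- One index `n` serves both unions: it is a value of the count in `A` and a round in `B`.
  have hsub : {ω : Sample m Ξ | ¬ M.IsGood T ε (M.state O F T ε ω.rand t)}
      ⊆ ⋃ i ∈ (Finset.univ : Finset (Fin m)), ⋃ n ∈ Finset.Icc 1 t, (A i n ∪ B i n) := by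
    intro ω hω
    by_contra hcon
    simp only [Set.mem_iUnion, Finset.mem_univ, exists_prop, true_and, not_exists, not_and,
      Set.mem_union, not_or, hA, hB, Set.mem_ofPred_eq, not_le] at hcon
    refine hω fun i => M.ucb_bounds hT hε O F ω.rand t i ?_ ?_
    · exact fun n hn hc => (hcon i n hn).1 hc
    · exact fun τ hτ => (hcon i τ hτ).2
  have hAB : ∀ i : Fin m, ∀ n ∈ Finset.Icc 1 t,
      (M.randomLaw O).real (A i n ∪ B i n) ≤ 18 / T ^ 2 := by
    intro i n hn
    obtain ⟨hn1, hn2⟩ := Finset.mem_Icc.1 hn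
    have hm : (1 : ℝ) ≤ m := by exact_mod_cast i.pos
    have hL : x ≤ Real.log (m * T) := Real.log_le_log hT0 (by nlinarith)
    have hx0 : 0 ≤ x := Real.log_nonneg (by exact_mod_cast (by omega : 1 ≤ T))
    have h1 : (M.randomLaw O).real (A i n) ≤ 2 / T ^ 2 := by
      refine (M.measureReal_deviation_ge_le O F T ε i t (by omega) (hx0.trans hL)).trans ?_
      rw [hTx, ← Real.exp_nat_mul, div_eq_mul_inv, ← Real.exp_neg]
      rw [hTx] at hL
      gcongr
      push_cast
      linarith
    have h2 : (M.randomLaw O).real (B i n) ≤ 16 / T ^ 2 := by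
      refine (M.measureReal_noise_ge_le O (by omega) i _).trans ?_
      have hnT : (n : ℝ) ≤ T := by exact_mod_cast hn2.trans ht
      have hexp : Real.exp (-(1 / 2) * (6 * Real.log 2 * x ^ 2)) ≤ 8 * Real.exp (-(3 * x)) := by
        have h8 : (8 : ℝ) = Real.exp (3 * Real.log 2) := by
          rw [show (3 : ℝ) * Real.log 2 = ((3 : ℕ) : ℝ) * Real.log 2 by norm_num,
            Real.exp_nat_mul, Real.exp_log (by norm_num)]
          norm_num
        rw [h8, ← Real.exp_add]
        refine Real.exp_le_exp.2 ?_
        -- The claim reduces to `x ≤ ln 2 (x² + 1)`, true for all `x` because `ln 2 > 1/2`.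
        have hl2 := Real.log_two_gt_d9
        nlinarith [sq_nonneg (x - 3 / 4), mul_nonneg (sub_nonneg.2 hl2.le) (sq_nonneg x)]
      calc _ ≤ 8 * Real.exp (-(3 * x)) * (2 * T) := by gcongr
        _ = 16 / T ^ 2 := by
          rw [hTx, Real.exp_neg, ← Real.exp_nat_mul, show 3 * x = ((2 : ℕ) : ℝ) * x + x by
            push_cast; ring, Real.exp_add]
          field_simp
          norm_num
    calc _ ≤ _ := measureReal_union_le _ _
      _ ≤ 2 / T ^ 2 + 16 / T ^ 2 := add_le_add h1 h2
      _ = 18 / (T : ℝ) ^ 2 := by ring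
  calc _ ≤ _ := measureReal_mono hsub (measure_ne_top _ _)
    _ ≤ ∑ i : Fin m, ∑ n ∈ Finset.Icc 1 t, (M.randomLaw O).real (A i n ∪ B i n) :=
        (measureReal_biUnion_finset_le _ _).trans
          (Finset.sum_le_sum fun i _ => measureReal_biUnion_finset_le _ _)
    _ ≤ ∑ i : Fin m, ∑ n ∈ Finset.Icc 1 t, 18 / (T : ℝ) ^ 2 :=
        Finset.sum_le_sum fun i _ => Finset.sum_le_sum (hAB i)
    _ = 18 * m / T * (t / T) := by
        simp only [Finset.sum_const, Finset.card_univ, Fintype.card_fin, Nat.card_Icc,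
          nsmul_eq_mul, Nat.add_sub_cancel]
        field_simp
    _ ≤ 18 * m / T * 1 := by
        gcongr
        exact (div_le_one hT0).2 (by exact_mod_cast ht)
    _ = _ := mul_one _

theorem measurableSet_isGood (O : M.Oracle α β Ξ) (F : M.FreeRule Ξ) (T : ℕ) (ε : ℝ) (t : ℕ) :
    MeasurableSet {ω : Sample m Ξ | M.IsGood T ε (M.state O F T ε ω.rand t)} := by
  simp only [IsGood, Set.ofPred_forall]
  refine MeasurableSet.iInter fun i => ?_
  have hu := M.measurable_ucb O F T ε t i
  have hc := M.measurable_count O F T ε t i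
  have hr : Measurable fun ω : Sample m Ξ =>
      2 * M.radius T ε ((M.state O F T ε ω.rand t).count i) :=
    (Measurable.of_discrete (f := fun n : ℕ => 2 * M.radius T ε n)).comp hc
  refine (measurableSet_le measurable_const hu).inter ?_
  simp only [imp_iff_not_or, not_not]
  exact (hc (measurableSet_singleton 0)).union (measurableSet_le (hu.sub_const _) hr)

end SemiBandit
end DPCSB

namespace DPCSB
namespace SemiBandit

variable {m : ℕ} (M : SemiBandit m) {α β : ℝ} {Ξ : Type*} [MeasurableSpace Ξ]

/-! ### Reduction of the regret to charges of the played base arms -/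

theorem mean_mem_cube : M.mean ∈ cube m := fun i => M.mean_mem i

theorem reward_le_opt (ν : Fin m → ℝ) {S : Finset (Fin m)} (hS : S ∈ M.superArms) :
    M.reward ν S ≤ M.opt ν :=
  Finset.le_sup' (M.reward ν) hS

theorem opt_mono (hmono : M.IsMonotone) {ν ν' : Fin m → ℝ} (hν : ν ∈ cube m) (hν' : ν' ∈ cube m)
    (h : ∀ i, ν i ≤ ν' i) : M.opt ν ≤ M.opt ν' :=
  Finset.sup'_le _ _ fun S hS => (hmono ν hν ν' hν' h S hS).trans (M.reward_le_opt ν' hS)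

theorem opt_mean_nonneg : 0 ≤ M.opt M.mean :=
  let ⟨_, hS⟩ := M.superArms_nonempty
  (M.reward_nonneg _ M.mean_mem_cube _ hS).trans (M.reward_le_opt _ hS)

/-- Optimism: `α opt(μ) ≤ α opt(ν) ≤ r_ν(S)`, and smoothness compares `r_ν(S)` with `r_μ(S)`. -/
theorem gap_le_of_approx {B₁ : ℝ} (hsmooth : M.IsBoundedSmooth B₁) (hmono : M.IsMonotone)
    (hα : 0 < α) {ν : Fin m → ℝ} (hν : ν ∈ cube m) (h : ∀ i, M.mean i ≤ ν i)
    {S : Finset (Fin m)} (hS : S ∈ M.superArms) (hap : α * M.opt ν ≤ M.reward ν S) :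
    M.gap α S ≤ B₁ * ∑ i ∈ S, (ν i - M.mean i) := by
  have h1 := mul_le_mul_of_nonneg_left (M.opt_mono hmono M.mean_mem_cube hν h) hα.le
  have h2 := (le_abs_self _).trans (hsmooth ν hν M.mean M.mean_mem_cube S hS)
  simp only [abs_of_nonneg (sub_nonneg.2 (h _))] at h2
  unfold gap
  linarith

theorem IsGood.mem_cube {T : ℕ} {ε : ℝ} {s : State m} (hs : M.IsGood T ε s) :
    s.ucb M.K T ε ∈ cube m :=
  fun i => ⟨(M.mean_mem i).1.trans (hs i).1, ucb_le_one s _ _ _ i⟩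

/-- The event that the gap of the super arm played is explained by the upper confidence bounds. -/
def IsExplained (α B₁ : ℝ) (T : ℕ) (ε : ℝ) (s : State m) (S : Finset (Fin m)) : Prop :=
  M.gap α S ≤ B₁ * ∑ i ∈ S, (s.ucb M.K T ε i - M.mean i)

theorem measurableSet_isExplained (O : M.Oracle α β Ξ) (F : M.FreeRule Ξ) (B₁ : ℝ) (T : ℕ) (ε : ℝ)
    (t : ℕ) : MeasurableSet {ω : Sample m Ξ |
      M.IsExplained α B₁ T ε (M.state O F T ε ω.rand t) (M.played O F T ε ω.rand t)} := by
  have heq : {ω : Sample m Ξ |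
      M.IsExplained α B₁ T ε (M.state O F T ε ω.rand t) (M.played O F T ε ω.rand t)}
      = ⋃ S, {ω : Sample m Ξ | M.played O F T ε ω.rand t = S} ∩
        {ω : Sample m Ξ | M.IsExplained α B₁ T ε (M.state O F T ε ω.rand t) S} := by
    ext ω
    simp
  rw [heq]
  refine MeasurableSet.iUnion fun S => MeasurableSet.inter
    (M.measurable_played O F T ε t (measurableSet_singleton S)) ?_
  exact measurableSet_le measurable_const (Measurable.const_mul (Finset.measurable_sum _
    fun i _ => (M.measurable_ucb O F T ε t i).sub_const _) _)

/-- Goodness of the state does not depend on the seed of round `t + 1`; resampling that seed makes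
the oracle succeed with probability at least `β` on every good history. -/
theorem mul_measureReal_isGood_le {B₁ : ℝ} (hsmooth : M.IsBoundedSmooth B₁)
    (hmono : M.IsMonotone) (hα : 0 < α) (hβ : 0 < β) (O : M.Oracle α β Ξ) (F : M.FreeRule Ξ)
    (T : ℕ) (ε : ℝ) (t : ℕ) :
    β * (M.randomLaw O).real {ω : Sample m Ξ | M.IsGood T ε (M.state O F T ε ω.rand t)}
      ≤ (M.randomLaw O).real ({ω : Sample m Ξ | M.IsGood T ε (M.state O F T ε ω.rand t)} ∩
          {ω : Sample m Ξ | M.IsExplained α B₁ T ε (M.state O F T ε ω.rand t)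
            (M.played O F T ε ω.rand t)}) := by
  set N := {ω : Sample m Ξ | M.IsGood T ε (M.state O F T ε ω.rand t)} with hN
  set E := {ω : Sample m Ξ | M.IsExplained α B₁ T ε (M.state O F T ε ω.rand t)
            (M.played O F T ε ω.rand t)} with hE
  have hNm : MeasurableSet N := M.measurableSet_isGood O F T ε t
  have hEm : MeasurableSet E := M.measurableSet_isExplained O F B₁ T ε t
  have key : ENNReal.ofReal β * M.randomLaw O N ≤ M.randomLaw O (N ∩ E) := by
    rw [← one_mul (M.randomLaw O (N ∩ E)), ← lintegral_indicator_const (hNm.inter hEm) 1, M.lintegral_update_seed O (t + 1)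
      ((measurable_const (a := (1 : ENNReal))).indicator (hNm.inter hEm)),
      ← lintegral_indicator_const hNm]
    refine lintegral_mono fun ω : Sample m Ξ => ?_
    by_cases hω : ω ∈ N
    · rw [Set.indicator_of_mem hω]
      have hcube := IsGood.mem_cube M hω
      have hsub : {ξ | α * M.opt ((M.state O F T ε (Sample.rand ω) t).ucb M.K T ε)
            ≤ M.reward ((M.state O F T ε (Sample.rand ω) t).ucb M.K T ε)
              (O.run ((M.state O F T ε (Sample.rand ω) t).ucb M.K T ε) ξ)}
          ⊆ {ξ | (ω.1, ω.2.1, Function.update ω.2.2 (t + 1) ξ) ∈ N ∩ E} := by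
        intro ξ hξ
        refine ⟨?_, ?_⟩
        · simp only [hN, Set.mem_ofPred_eq, state_update_seed]
          exact hω
        · simp only [hE, Set.mem_ofPred_eq, state_update_seed, played_update_seed]
          rw [select, if_pos fun i => (hcube i).1]
          exact M.gap_le_of_approx hsmooth hmono hα hcube (fun i => (hω i).1)
            (O.run_mem _ hcube ξ) hξ
      refine (O.approx _ hcube).trans ((measure_mono hsub).trans ?_)
      rw [← one_mul (O.seedLaw _)]
      refine (le_of_eq ?_).trans (mul_meas_ge_le_lintegral₀ (μ := O.seedLaw) (ε := 1) (f := fun ξ =>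
        (N ∩ E).indicator (fun _ => (1 : ENNReal))
          (ω.1, ω.2.1, Function.update ω.2.2 (t + 1) ξ)) ?_)
      · congr 2
        ext ξ
        by_cases h : (ω.1, ω.2.1, Function.update ω.2.2 (t + 1) ξ) ∈ N ∩ E
        · simp only [Set.mem_ofPred_eq, h, Set.indicator_of_mem, le_refl]
        · simp only [Set.mem_ofPred_eq, h, Set.indicator_of_notMem, not_false_eq_true]
          simp
      · have hup : Measurable fun ξ : Ξ =>
            (ω.1, ω.2.1, Function.update ω.2.2 (t + 1) ξ) := by
          exact measurable_const.prodMk (measurable_const.prodMk (measurable_update _))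
        exact ((measurable_const.indicator (hNm.inter hEm)).comp hup).aemeasurable
    · rw [Set.indicator_of_notMem hω]
      exact zero_le
  have h := ENNReal.toReal_mono (measure_ne_top _ _) key
  rwa [ENNReal.toReal_mul, ENNReal.toReal_ofReal hβ.le] at h

theorem integrable_comp_played (O : M.Oracle α β Ξ) (F : M.FreeRule Ξ) (T : ℕ) (ε : ℝ) (t : ℕ)
    (g : Finset (Fin m) → ℝ) :
    Integrable (fun ω : Sample m Ξ => g (M.played O F T ε ω.rand t)) (M.randomLaw O) := by
  refine Integrable.of_bound ((Measurable.of_discrete (f := g)).comp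
    (M.measurable_played O F T ε t)).aestronglyMeasurable (∑ S, |g S|)
    (Filter.Eventually.of_forall fun ω => ?_)
  exact Finset.single_le_sum (f := fun S => |g S|) (fun _ _ => abs_nonneg _) (Finset.mem_univ _)

open Classical in
theorem integrable_charge (O : M.Oracle α β Ξ) (F : M.FreeRule Ξ) (T : ℕ) (ε : ℝ) (t : ℕ)
    (φ : Fin m → ℕ → ℝ) :
    Integrable (fun ω : Sample m Ξ => ∑ i, if i ∈ M.played O F T ε ω.rand t
      then φ i ((M.state O F T ε ω.rand t).count i) else 0) (M.randomLaw O) := by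
  refine integrable_finsetSum _ fun i _ => ?_
  refine Integrable.of_bound (Measurable.ite
    (M.measurable_played O F T ε t (measurableSet_mem_finset i))
    ((Measurable.of_discrete (f := φ i)).comp (M.measurable_count O F T ε t i))
    measurable_const).aestronglyMeasurable (∑ n ∈ Finset.range (t + 1), |φ i n|)
    (Filter.Eventually.of_forall fun ω => ?_)
  split_ifs
  · exact Finset.single_le_sum (f := fun n => |φ i n|) (fun _ _ => abs_nonneg _)
      (Finset.mem_range.2 (Nat.lt_succ_of_le (M.count_le O F T ε _ t i)))
  · simpa using Finset.sum_nonneg fun n _ => abs_nonneg (φ i n)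

open Classical in
theorem integral_sub_reward_le {B₁ : ℝ} (hsmooth : M.IsBoundedSmooth B₁)
    (hmono : M.IsMonotone) (hα : 0 < α) (hβ : 0 < β) (hβ1 : β ≤ 1) (O : M.Oracle α β Ξ)
    (F : M.FreeRule Ξ) (T : ℕ) (ε : ℝ) {D : ℝ} (hgap : ∀ S ∈ M.superArms, M.gap α S ≤ D)
    {φ : Fin m → ℕ → ℝ} (hφ : ∀ i n, 0 ≤ φ i n)
    (hcharge : ∀ s : State m, M.IsGood T ε s → ∀ S ∈ M.superArms,
      M.IsExplained α B₁ T ε s S → M.gap α S ≤ ∑ i ∈ S, φ i (s.count i)) (t : ℕ) :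
    α * β * M.opt M.mean - ∫ ω : Sample m Ξ, M.reward M.mean (M.played O F T ε ω.rand t)
        ∂M.randomLaw O
      ≤ D * (M.randomLaw O).real {ω : Sample m Ξ | ¬ M.IsGood T ε (M.state O F T ε ω.rand t)}
        + ∫ ω : Sample m Ξ, (∑ i, if i ∈ M.played O F T ε ω.rand t
            then φ i ((M.state O F T ε ω.rand t).count i) else 0) ∂M.randomLaw O := by
  set N := {ω : Sample m Ξ | M.IsGood T ε (M.state O F T ε ω.rand t)} with hN
  set E := {ω : Sample m Ξ | M.IsExplained α B₁ T ε (M.state O F T ε ω.rand t)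
            (M.played O F T ε ω.rand t)} with hE
  set Φ : Sample m Ξ → ℝ := fun ω => ∑ i, if i ∈ M.played O F T ε ω.rand t
            then φ i ((M.state O F T ε ω.rand t).count i) else 0 with hΦ
  set P := M.randomLaw O with hP
  have hNm : MeasurableSet N := M.measurableSet_isGood O F T ε t
  have hEm : MeasurableSet E := M.measurableSet_isExplained O F B₁ T ε t
  have hor := M.mul_measureReal_isGood_le hsmooth hmono hα hβ O F T ε t
  have hopt := M.opt_mean_nonneg
  have hΦint : Integrable Φ P := M.integrable_charge O F T ε t φ
  have hΦ0 : ∀ ω, 0 ≤ Φ ω := fun ω => Finset.sum_nonneg fun i _ => by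
    split_ifs
    · exact hφ _ _
    · exact le_rfl
  have hrint : Integrable (fun ω : Sample m Ξ => M.reward M.mean (M.played O F T ε ω.rand t)) P :=
    M.integrable_comp_played O F T ε t _
  have hind : ∀ {A : Set (Sample m Ξ)} (c : ℝ), MeasurableSet A →
      Integrable (A.indicator fun _ => c) P ∧ ∫ ω, A.indicator (fun _ => c) ω ∂P = c * P.real A :=
    fun {A} c hA => ⟨(integrable_const c).indicator hA, by
      rw [integral_indicator_const _ hA, smul_eq_mul, mul_comm]⟩
  -- Off the good event the loss is at most the gap. On good but unexplained rounds only `reward ≥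
  -- 0` is used, at cost `α β opt`. On explained rounds the loss is the gap minus `α (1 - β) opt`.
  have hpt : ∀ ω : Sample m Ξ, α * β * M.opt M.mean - M.reward M.mean (M.played O F T ε ω.rand t)
      ≤ Nᶜ.indicator (fun _ => D) ω + Φ ω + N.indicator (fun _ => α * β * M.opt M.mean) ω
        - (N ∩ E).indicator (fun _ => α * M.opt M.mean) ω := by
    intro ω
    have hmem := M.played_mem O F T ε ω.rand t
    by_cases h1 : ω ∈ N
    · by_cases h2 : ω ∈ E
      · have hc := hcharge _ h1 _ hmem h2
        have hΦω : Φ ω = ∑ i ∈ M.played O F T ε ω.rand t,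
            φ i ((M.state O F T ε ω.rand t).count i) := by
          simp only [hΦ, ← Finset.sum_filter, Finset.filter_mem_eq_inter, Finset.univ_inter]
        rw [← hΦω, gap] at hc
        rw [Set.indicator_of_notMem (by simpa using h1), Set.indicator_of_mem h1,
          Set.indicator_of_mem (show ω ∈ N ∩ E from ⟨h1, h2⟩)]
        linarith
      · rw [Set.indicator_of_notMem (by simpa using h1), Set.indicator_of_mem h1,
          Set.indicator_of_notMem fun h => h2 h.2]
        linarith [hΦ0 ω, M.reward_nonneg _ M.mean_mem_cube _ hmem]
    · rw [Set.indicator_of_mem (Set.mem_compl h1), Set.indicator_of_notMem h1,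
        Set.indicator_of_notMem fun h => h1 h.1]
      have hg := hgap _ hmem
      rw [gap] at hg
      nlinarith [hΦ0 ω, mul_nonneg hα.le hopt]
  have hcompl : {ω : Sample m Ξ | ¬ M.IsGood T ε (M.state O F T ε ω.rand t)} = Nᶜ := rfl
  rw [hcompl]
  calc α * β * M.opt M.mean - ∫ ω : Sample m Ξ, M.reward M.mean (M.played O F T ε ω.rand t) ∂P
      = ∫ ω : Sample m Ξ, (α * β * M.opt M.mean
          - M.reward M.mean (M.played O F T ε ω.rand t)) ∂P := by
        rw [integral_sub (integrable_const _) hrint]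
        simp
    _ ≤ ∫ ω : Sample m Ξ, (Nᶜ.indicator (fun _ => D) ω + Φ ω
          + N.indicator (fun _ => α * β * M.opt M.mean) ω
          - (N ∩ E).indicator (fun _ => α * M.opt M.mean) ω) ∂P :=
        integral_mono ((integrable_const _).sub hrint)
          (((((hind D hNm.compl).1).add hΦint).add (hind _ hNm).1).sub
            (hind _ (hNm.inter hEm)).1) hpt
    _ = D * P.real Nᶜ + ∫ ω, Φ ω ∂P + α * β * M.opt M.mean * P.real N
          - α * M.opt M.mean * P.real (N ∩ E) := by
        have e1 : Integrable (fun ω => Nᶜ.indicator (fun _ => D) ω + Φ ω) P :=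
          (hind D hNm.compl).1.add hΦint
        have e2 : Integrable (fun ω => Nᶜ.indicator (fun _ => D) ω + Φ ω
            + N.indicator (fun _ => α * β * M.opt M.mean) ω) P := e1.add (hind _ hNm).1
        rw [integral_sub e2 (hind _ (hNm.inter hEm)).1, integral_add e1 (hind _ hNm).1,
          integral_add (hind D hNm.compl).1 hΦint, (hind D hNm.compl).2, (hind _ hNm).2,
          (hind _ (hNm.inter hEm)).2]
    _ ≤ _ := by
        -- The two `opt` terms cancel in the right direction, since `β P(N) ≤ P(N ∩ E)`.
        have := mul_le_mul_of_nonneg_left hor (mul_nonneg hα.le hopt)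
        linarith

theorem regret_eq_sum (O : M.Oracle α β Ξ) (F : M.FreeRule Ξ) (T : ℕ) (ε : ℝ) :
    M.regret O F T ε = ∑ t ∈ Finset.range T, (α * β * M.opt M.mean
      - ∫ ω : Sample m Ξ, M.reward M.mean (M.played O F T ε ω.rand t) ∂M.randomLaw O) := by
  rw [regret, integral_finsetSum _ fun t _ => M.integrable_comp_played O F T ε t _,
    Finset.sum_sub_distrib]
  simp

theorem regret_le_mul (hα : 0 < α) (hβ1 : β ≤ 1) (O : M.Oracle α β Ξ) (F : M.FreeRule Ξ) (T : ℕ)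
    (ε : ℝ) {D : ℝ} (hgap : ∀ S ∈ M.superArms, M.gap α S ≤ D) : M.regret O F T ε ≤ T * D := by
  rw [regret_eq_sum]
  refine (Finset.sum_le_card_nsmul _ _ D fun t _ => ?_).trans (by simp)
  have hopt := mul_nonneg hα.le M.opt_mean_nonneg
  have h : α * M.opt M.mean - D
      ≤ ∫ ω : Sample m Ξ, M.reward M.mean (M.played O F T ε ω.rand t) ∂M.randomLaw O := by
    calc α * M.opt M.mean - D = ∫ _ : Sample m Ξ, (α * M.opt M.mean - D) ∂M.randomLaw O := by simp
      _ ≤ _ := integral_mono (integrable_const _) (M.integrable_comp_played O F T ε t _)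
          fun ω => by
            have := hgap _ (M.played_mem O F T ε (Sample.rand ω) t)
            rw [gap] at this
            linarith
  nlinarith

open Classical in
-- Each play of `i` raises its count by one, so every count below the current one has been charged
-- exactly once.
theorem sum_charge_eq (O : M.Oracle α β Ξ) (F : M.FreeRule Ξ) (T : ℕ) (ε : ℝ)
    (ω : Randomness m Ξ) (φ : Fin m → ℕ → ℝ) (t : ℕ) :
    ∑ τ ∈ Finset.range t, (∑ i, if i ∈ M.played O F T ε ω τ
        then φ i ((M.state O F T ε ω τ).count i) else 0)
      = ∑ i, ∑ n ∈ Finset.range ((M.state O F T ε ω t).count i), φ i n := by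
  induction t with
  | zero => simp [state, State.init]
  | succ t ih =>
    rw [Finset.sum_range_succ, ih, ← Finset.sum_add_distrib]
    refine Finset.sum_congr rfl fun i _ => ?_
    rw [state_succ_count]
    by_cases h : i ∈ M.played O F T ε ω t
    · simp [h, Finset.sum_range_succ]
    · simp [h]

theorem regret_le_of_charge {B₁ : ℝ} (hsmooth : M.IsBoundedSmooth B₁)
    (hmono : M.IsMonotone) (hα : 0 < α) (hβ : 0 < β) (hβ1 : β ≤ 1) (O : M.Oracle α β Ξ)
    (F : M.FreeRule Ξ) {T : ℕ} (hT : 2 ≤ T) {ε : ℝ} (hε : 0 < ε) {D : ℝ} (hD : 0 ≤ D)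
    (hgap : ∀ S ∈ M.superArms, M.gap α S ≤ D)
    {φ : Fin m → ℕ → ℝ} (hφ : ∀ i n, 0 ≤ φ i n)
    (hcharge : ∀ s : State m, M.IsGood T ε s → ∀ S ∈ M.superArms,
      M.IsExplained α B₁ T ε s S → M.gap α S ≤ ∑ i ∈ S, φ i (s.count i)) :
    M.regret O F T ε ≤ 18 * (m * D) + ∑ i, ∑ n ∈ Finset.range T, φ i n := by
  classical
  have hT0 : (0 : ℝ) < T := by positivity
  rw [regret_eq_sum]
  refine (Finset.sum_le_sum fun t _ => M.integral_sub_reward_le hsmooth hmono hα hβ hβ1 O F T ε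
    hgap hφ hcharge t).trans ?_
  rw [Finset.sum_add_distrib]
  refine add_le_add ?_ ?_
  · calc _ ≤ ∑ t ∈ Finset.range T, D * (18 * m / T) := Finset.sum_le_sum fun t ht =>
          mul_le_mul_of_nonneg_left
            (M.measureReal_not_isGood_le hT hε O F (Finset.mem_range.1 ht).le) hD
      _ = 18 * (m * D) := by
          rw [Finset.sum_const, Finset.card_range, nsmul_eq_mul]
          field_simp
  · rw [← integral_finsetSum _ fun t _ => M.integrable_charge O F T ε t φ]
    calc _ ≤ ∫ _ : Sample m Ξ, (∑ i, ∑ n ∈ Finset.range T, φ i n) ∂M.randomLaw O := by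
          refine integral_mono (integrable_finsetSum _ fun t _ => M.integrable_charge O F T ε t φ)
            (integrable_const _) fun ω => ?_
          simp only [sum_charge_eq]
          refine Finset.sum_le_sum fun i _ => Finset.sum_le_sum_of_subset_of_nonneg
            (Finset.range_mono (M.count_le O F T ε _ T i)) fun n _ _ => hφ i n
      _ = _ := by simp

end SemiBandit
end DPCSB

namespace DPCSB

/-! ### Charging the gap of a super arm to its base arms -/

theorem sum_Icc_inv_le {a b : ℕ} (ha : 1 ≤ a) (hab : a ≤ b) :
    ∑ n ∈ Finset.Icc a b, (1 : ℝ) / n ≤ 1 + Real.log (b / a) := by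
  have ha0 : (0 : ℝ) < a := by positivity
  induction b, hab using Nat.le_induction with
  | base =>
    simp only [Finset.Icc_self, Finset.sum_singleton, div_self ha0.ne', Real.log_one, add_zero]
    exact (div_le_one ha0).2 (by exact_mod_cast ha)
  | succ b hab ih =>
    have hb0 : (0 : ℝ) < b := by exact_mod_cast lt_of_lt_of_le ha hab
    rw [Finset.sum_Icc_succ_top (by omega)]
    have h1 := Real.one_sub_inv_le_log_of_pos (show (0 : ℝ) < ((b : ℝ) + 1) / b by positivity)
    have h2 : 1 - (((b : ℝ) + 1) / b)⁻¹ = 1 / (b + 1) := by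
      field_simp
      ring
    have h3 : Real.log (((b + 1 : ℕ) : ℝ) / a) = Real.log (b / a) + Real.log (((b : ℝ) + 1) / b) := by
      rw [← Real.log_mul (by positivity) (by positivity)]
      congr 1
      push_cast
      field_simp
    rw [h3]
    push_cast
    linarith

theorem sum_range_window_le {A B : ℝ} (hA : 0 < A) (hAB : A ≤ B) (T : ℕ) :
    ∑ n ∈ Finset.range T, (if A < n ∧ n ≤ B then (1 : ℝ) / n else 0) ≤ 1 + Real.log (B / A) := by
  have hlog : 0 ≤ Real.log (B / A) := Real.log_nonneg ((one_le_div hA).2 hAB)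
  rw [← Finset.sum_filter]
  have hsub : (Finset.range T).filter (fun n : ℕ => A < n ∧ n ≤ B)
      ⊆ Finset.Icc (⌊A⌋₊ + 1) ⌊B⌋₊ := by
    intro n hn
    simp only [Finset.mem_filter] at hn
    exact Finset.mem_Icc.2 ⟨(Nat.floor_lt hA.le).2 hn.2.1, Nat.le_floor hn.2.2⟩
  refine (Finset.sum_le_sum_of_subset_of_nonneg hsub fun n _ _ => by positivity).trans ?_
  rcases le_or_gt (⌊A⌋₊ + 1) ⌊B⌋₊ with h | h
  · refine (sum_Icc_inv_le (by omega) h).trans ?_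
    have hB : ((⌊B⌋₊ : ℕ) : ℝ) ≤ B := Nat.floor_le (hA.le.trans hAB)
    have hA' : A ≤ ((⌊A⌋₊ + 1 : ℕ) : ℝ) := by
      push_cast
      exact (Nat.lt_floor_add_one A).le
    have hB0 : (0 : ℝ) < (⌊B⌋₊ : ℕ) := by exact_mod_cast (by omega : 0 < ⌊B⌋₊)
    gcongr
    exact hA.trans_le hAB |>.le
  · rw [Finset.Icc_eq_empty (by omega), Finset.sum_empty]
    linarith

theorem sum_range_le_threshold_le {A D : ℝ} (hA : 0 ≤ A) (hD : 0 ≤ D) (T : ℕ) :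
    ∑ n ∈ Finset.range T, (if (n : ℝ) ≤ A then D else 0) ≤ (A + 1) * D := by
  rw [← Finset.sum_filter, Finset.sum_const, nsmul_eq_mul]
  gcongr
  have hsub : (Finset.range T).filter (fun n : ℕ => (n : ℝ) ≤ A) ⊆ Finset.range (⌊A⌋₊ + 1) := by
    intro n hn
    simp only [Finset.mem_filter] at hn
    exact Finset.mem_range.2 (Nat.lt_succ_of_le (Nat.le_floor hn.2))
  have h := Finset.card_le_card hsub
  rw [Finset.card_range] at h
  calc _ ≤ ((⌊A⌋₊ + 1 : ℕ) : ℝ) := by exact_mod_cast h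
    _ ≤ A + 1 := by
      push_cast
      linarith [Nat.floor_le hA]

theorem sum_range_inv_le {T : ℕ} (hT : 2 ≤ T) :
    ∑ n ∈ Finset.range T, (1 : ℝ) / n ≤ 1 + Real.log T := by
  have h := sum_Icc_inv_le (le_refl 1) (show 1 ≤ T by omega)
  simp only [Nat.cast_one, div_one] at h
  refine le_trans ?_ h
  -- The term `n = 0` is `1 / 0 = 0`.
  calc ∑ n ∈ Finset.range T, (1 : ℝ) / n ≤ ∑ n ∈ insert 0 (Finset.Icc 1 T), (1 : ℝ) / n := by
        refine Finset.sum_le_sum_of_subset_of_nonneg ?_ fun n _ _ => by positivity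
        intro n hn
        have := Finset.mem_range.1 hn
        simp only [Finset.mem_insert, Finset.mem_Icc]
        omega
    _ = _ := by
        rw [Finset.sum_insert (by simp)]
        simp

/-- The charge to a base arm with smallest positive gap `δ` that has been played `n` times: at most
`D` while `n ≤ B c / D`, then `4 B c / n` as long as this can exceed `δ / K`, and
`4 B² K q / (δ n)` throughout. -/
noncomputable def charge (B c q D K δ : ℝ) (n : ℕ) : ℝ :=
  (if (n : ℝ) ≤ B * c / D then D else 0)
    + 4 * B * c * (if B * c / D < n ∧ n ≤ 4 * B * c * K / δ then (1 : ℝ) / n else 0)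
    + 4 * B ^ 2 * K * q / δ * (1 / n)

theorem charge_nonneg {B c q D K δ : ℝ} (hB : 0 ≤ B) (hc : 0 ≤ c) (hq : 0 ≤ q) (hD : 0 ≤ D)
    (hK : 0 ≤ K) (hδ : 0 ≤ δ) (n : ℕ) : 0 ≤ charge B c q D K δ n := by
  unfold charge
  positivity

theorem le_sum_charge {ι : Type*} (S : Finset ι) {B c q D g : ℝ} {K : ℕ} (hK : S.card ≤ K)
    (hB : 0 < B) (hc : 0 ≤ c) (hq : 0 ≤ q) (hg : 0 < g) (hgD : g ≤ D) {δ u : ι → ℝ} (n : ι → ℕ)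
    (hδ : ∀ i ∈ S, 0 < δ i ∧ δ i ≤ g) (hgu : g ≤ B * ∑ i ∈ S, u i)
    (hu : ∀ i ∈ S, n i ≠ 0 → u i ≤ √(q / n i) + c / n i) :
    g ≤ ∑ i ∈ S, charge B c q D K (δ i) (n i) := by
  have hD : 0 < D := hg.trans_le hgD
  have hnn : ∀ i ∈ S, 0 ≤ charge B c q D K (δ i) (n i) := fun i hi =>
    charge_nonneg hB.le hc hq hD.le (by positivity) (hδ i hi).1.le _
  -- A single rarely played arm pays the whole gap with its `D`. This covers unplayed arms, for
  -- which `hu` gives no width bound.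
  by_cases hsmall : ∃ i ∈ S, (n i : ℝ) ≤ B * c / D
  · obtain ⟨i, hi, hni⟩ := hsmall
    refine hgD.trans (le_trans ?_ (Finset.single_le_sum hnn hi))
    have := (hδ i hi).1
    rw [charge, if_pos hni]
    have h1 : 0 ≤ 4 * B * c * (if B * c / D < n i ∧ n i ≤ 4 * B * c * K / δ i
      then (1 : ℝ) / n i else 0) := by positivity
    have h2 : 0 ≤ 4 * B ^ 2 * K * q / δ i * (1 / n i) := by positivity
    linarith
  push Not at hsmall
  have hn0 : ∀ i ∈ S, (0 : ℝ) < n i := fun i hi =>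
    lt_of_le_of_lt (by positivity) (hsmall i hi)
  have hsplit : g ≤ B * ∑ i ∈ S, √(q / n i) + B * ∑ i ∈ S, c / n i := by
    rw [← mul_add, ← Finset.sum_add_distrib]
    refine hgu.trans (mul_le_mul_of_nonneg_left (Finset.sum_le_sum fun i hi => ?_) hB.le)
    exact hu i hi (by exact_mod_cast (hn0 i hi).ne')
  have hcard : (S.card : ℝ) ≤ K := by exact_mod_cast hK
  -- One of the two parts accounts for half of `g`. If it is the square root part, Cauchy–Schwarz
  -- bounds `g²`, and dividing by `g ≥ δ i` gives the last term of `charge`.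
  rcases le_or_gt g (2 * (B * ∑ i ∈ S, √(q / n i))) with h | h
  · have hsq : g * g ≤ 4 * B ^ 2 * K * ∑ i ∈ S, q / n i := by
      calc g * g ≤ (2 * (B * ∑ i ∈ S, √(q / n i))) * (2 * (B * ∑ i ∈ S, √(q / n i))) :=
            mul_self_le_mul_self hg.le h
        _ = 4 * B ^ 2 * (∑ i ∈ S, √(q / n i)) ^ 2 := by ring
        _ ≤ 4 * B ^ 2 * (S.card * ∑ i ∈ S, √(q / n i) ^ 2) := by
            gcongr
            exact sq_sum_le_card_mul_sum_sq
        _ = 4 * B ^ 2 * (S.card * ∑ i ∈ S, q / n i) := by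
            congr 2
            exact Finset.sum_congr rfl fun i _ => Real.sq_sqrt (by positivity)
        _ ≤ 4 * B ^ 2 * (K * ∑ i ∈ S, q / n i) := by
            have : 0 ≤ ∑ i ∈ S, q / n i := Finset.sum_nonneg fun i _ => by positivity
            gcongr
        _ = _ := by ring
    calc g ≤ (4 * B ^ 2 * K * ∑ i ∈ S, q / n i) / g := (le_div_iff₀ hg).2 hsq
      _ = ∑ i ∈ S, 4 * B ^ 2 * K * q / g * (1 / n i) := by
          rw [Finset.mul_sum, Finset.sum_div]
          exact Finset.sum_congr rfl fun i _ => by ring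
      _ ≤ _ := by
          refine Finset.sum_le_sum fun i hi => ?_
          obtain ⟨hδ0, hδg⟩ := hδ i hi
          have h1 : 4 * B ^ 2 * K * q / g * (1 / n i) ≤ 4 * B ^ 2 * K * q / δ i * (1 / n i) := by
            gcongr
          have h2 : 0 ≤ 4 * B * c * (if B * c / D < n i ∧ n i ≤ 4 * B * c * K / δ i
            then (1 : ℝ) / n i else 0) := by positivity
          rw [charge, if_neg (hsmall i hi).not_ge]
          linarith
  · have hK0 : (0 : ℝ) < K := by
      rcases S.eq_empty_or_nonempty with hS | hS
      · simp only [hS, Finset.sum_empty, mul_zero] at hgu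
        exact absurd hgu hg.not_ge
      · exact_mod_cast hS.card_pos.trans_le hK
    have hlow : ∑ i ∈ S, δ i / K ≤ g := by
      calc ∑ i ∈ S, δ i / K ≤ ∑ i ∈ S, g / K := Finset.sum_le_sum fun i hi => by
            have := (hδ i hi).2
            gcongr
        _ = S.card * (g / K) := by rw [Finset.sum_const, nsmul_eq_mul]
        _ ≤ K * (g / K) := by gcongr
        _ = g := by field_simp
    -- Write `g = 2 g - g` with `2 g ≤ 4 B ∑ c / n i` and `g ≥ ∑ δ i / K`. A summand is positive
    -- only for `n i < 4 B c K / δ i`, which is where the window ends.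
    have hup : g ≤ ∑ i ∈ S, (4 * B * (c / n i) - δ i / K) := by
      rw [Finset.sum_sub_distrib, ← Finset.mul_sum]
      linarith
    refine hup.trans (Finset.sum_le_sum fun i hi => ?_)
    obtain ⟨hδ0, hδg⟩ := hδ i hi
    have hni := hn0 i hi
    have h2 : 0 ≤ 4 * B ^ 2 * K * q / δ i * (1 / n i) := by positivity
    have h3 : 0 ≤ δ i / K := by positivity
    rw [charge, if_neg (hsmall i hi).not_ge]
    by_cases hw : (n i : ℝ) ≤ 4 * B * c * K / δ i
    · rw [if_pos ⟨hsmall i hi, hw⟩]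
      have : 4 * B * (c / n i) = 4 * B * c * (1 / n i) := by ring
      linarith
    · rw [if_neg fun h => hw h.2]
      have h4 : 4 * B * (c / n i) ≤ δ i / K := by
        rw [not_le, div_lt_iff₀ hδ0] at hw
        rw [← mul_div_assoc, div_le_div_iff₀ hni hK0]
        linarith
      linarith

theorem sum_charge_le {B c q D K δ : ℝ} (hB : 0 < B) (hc : 0 < c) (hq : 0 ≤ q)
    (hK : 1 ≤ K) (hδ : 0 < δ) (hδD : δ ≤ D) {T : ℕ} (hT : 2 ≤ T) :
    ∑ n ∈ Finset.range T, charge B c q D K δ n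
      ≤ B * c + D + 4 * B * c * (1 + Real.log (4 * K * D / δ))
        + 4 * B ^ 2 * K * q / δ * (1 + Real.log T) := by
  have hD : 0 < D := hδ.trans_le hδD
  have hAB : B * c / D ≤ 4 * B * c * K / δ := by
    rw [div_le_div_iff₀ hD hδ]
    have h1 : B * c * δ ≤ B * c * D := by gcongr
    have h2 : B * c * D * 1 ≤ B * c * D * (4 * K) := by
      gcongr
      linarith
    linarith
  have h1 := sum_range_le_threshold_le (A := B * c / D) (by positivity) hD.le T
  have h2 := sum_range_window_le (by positivity) hAB T
  have h3 := sum_range_inv_le hT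
  simp only [charge]
  rw [Finset.sum_add_distrib, Finset.sum_add_distrib, ← Finset.mul_sum, ← Finset.mul_sum]
  have e1 : (B * c / D + 1) * D = B * c + D := by field_simp
  have e2 : 4 * B * c * K / δ / (B * c / D) = 4 * K * D / δ := by field_simp
  rw [e1] at h1
  rw [e2] at h2
  gcongr

/-! ### Finiteness of the set of gaps, and the regret bound with explicit constants. -/

namespace SemiBandit

variable {m : ℕ} (M : SemiBandit m) {α β : ℝ} {Ξ : Type*} [MeasurableSpace Ξ]

theorem finite_gaps (α : ℝ) (p : Finset (Fin m) → Prop) :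
    {d | ∃ S ∈ M.superArms, p S ∧ d = M.gap α S}.Finite :=
  (M.superArms.finite_toSet.image (M.gap α)).subset fun _ ⟨S, hS, _, hd⟩ => ⟨S, hS, hd.symm⟩

theorem gapMax_nonneg (α : ℝ) : 0 ≤ M.gapMax α :=
  Real.sSup_nonneg fun _ ⟨_, _, h, hd⟩ => hd ▸ h.le

theorem gap_le_gapMax (α : ℝ) {S : Finset (Fin m)} (hS : S ∈ M.superArms) :
    M.gap α S ≤ M.gapMax α := by
  rcases le_or_gt (M.gap α S) 0 with h | h
  · exact h.trans (M.gapMax_nonneg α)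
  · exact le_csSup (M.finite_gaps α fun S => 0 < M.gap α S).bddAbove ⟨S, hS, h, rfl⟩

theorem finite_gaps_mem (α : ℝ) (i : Fin m) :
    {d | ∃ S ∈ M.superArms, i ∈ S ∧ 0 < M.gap α S ∧ d = M.gap α S}.Finite :=
  (M.finite_gaps α fun S => i ∈ S ∧ 0 < M.gap α S).subset
    fun _ ⟨S, hS, h1, h2, hd⟩ => ⟨S, hS, ⟨h1, h2⟩, hd⟩

theorem gapMin_pos_le {α : ℝ} {i : Fin m} {S : Finset (Fin m)} (hS : S ∈ M.superArms) (hi : i ∈ S)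
    (hg : 0 < M.gap α S) : 0 < M.gapMin α i ∧ M.gapMin α i ≤ M.gap α S := by
  have hfin := M.finite_gaps_mem α i
  have hmem : M.gap α S ∈ {d | ∃ S ∈ M.superArms, i ∈ S ∧ 0 < M.gap α S ∧ d = M.gap α S} :=
    ⟨S, hS, hi, hg, rfl⟩
  refine ⟨?_, csInf_le hfin.bddBelow hmem⟩
  obtain ⟨S', _, _, h, hd⟩ := Set.Nonempty.csInf_mem ⟨_, hmem⟩ hfin
  rw [gapMin, hd]
  exact h

theorem exists_of_gapMin_pos {α : ℝ} {i : Fin m} (h : 0 < M.gapMin α i) :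
    ∃ S ∈ M.superArms, i ∈ S ∧ 0 < M.gap α S := by
  by_contra hcon
  push Not at hcon
  have hempty : {d | ∃ S ∈ M.superArms, i ∈ S ∧ 0 < M.gap α S ∧ d = M.gap α S} = ∅ := by
    refine Set.eq_empty_of_forall_notMem ?_
    rintro d ⟨S, hS, hi, hg, -⟩
    exact (hcon S hS hi).not_gt hg
  rw [gapMin, hempty, Real.sInf_empty] at h
  exact lt_irrefl _ h

theorem gapTerm_nonneg (α B₁ : ℝ) (T : ℕ) : 0 ≤ M.gapTerm α B₁ T :=
  Finset.sum_nonneg fun i hi => by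
    have := (Finset.mem_filter.1 hi).2
    positivity

/-- The total charge of a base arm, in terms of the logarithms of the regret bound. -/
theorem sum_charge_le_posLog {B K D δ ε q : ℝ} (hB : 0 < B) (hK : 1 ≤ K) (hδ : 0 < δ)
    (hδD : δ ≤ D) (hε : 0 < ε) {T : ℕ} (hT : 2 ≤ T) (hq : 0 ≤ q) (hqT : q ≤ 32 * Real.log T) :
    ∑ n ∈ Finset.range T, charge B (24 * K * Real.log T ^ 3 / ε) q D K δ n
      ≤ D + 480 * (K * B ^ 2 * Real.log T ^ 2 / δ)
        + 312 * (K * B * Real.log T ^ 3 * (1 + Real.posLog (B * K * Real.log T / (D * ε))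
          + Real.posLog (D / B)) / ε) := by
  have hD : 0 < D := hδ.trans_le hδD
  have hK0 : 0 < K := by linarith
  set l := Real.log T with hl
  have hl2 : 1 / 2 < l := by
    have h1 := Real.log_two_gt_d9
    have h2 : Real.log 2 ≤ l := Real.log_le_log (by norm_num) (by exact_mod_cast hT)
    linarith
  have hl0 : 0 < l := by linarith
  set p := Real.posLog (B * K * l / (D * ε)) with hp
  set r := Real.posLog (D / B) with hr
  have hp0 : 0 ≤ p := Real.posLog_nonneg
  have hr0 : 0 ≤ r := Real.posLog_nonneg
  have hlog : Real.log (4 * K * D / δ) ≤ 2 + ε * B / (l * δ) + p + 2 * r := by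
    -- The factor with `δ` is estimated by `log y ≤ y`, the other two by `posLog`.
    have hfac : 4 * K * D / δ
        = 4 * (ε * B / (l * δ)) * (B * K * l / (D * ε)) * (D / B) ^ 2 := by
      field_simp
    have h4 : Real.log 4 ≤ 2 := by
      rw [show (4 : ℝ) = 2 ^ 2 by norm_num, Real.log_pow]
      have := Real.log_two_lt_d9
      push_cast
      linarith
    have h5 : Real.log (ε * B / (l * δ)) ≤ ε * B / (l * δ) := Real.log_le_self (by positivity)
    have h6 : Real.log (B * K * l / (D * ε)) ≤ p := le_max_right _ _
    have h7 : Real.log (D / B) ≤ r := le_max_right _ _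
    rw [hfac, Real.log_mul (by positivity) (by positivity), Real.log_mul (by positivity)
      (by positivity), Real.log_mul (by positivity) (by positivity), Real.log_pow]
    push_cast
    linarith
  refine (sum_charge_le hB (by positivity) hq hK hδ hδD hT).trans ?_
  set u := K * B ^ 2 * l ^ 2 / δ with hu
  set v := K * B * l ^ 3 / ε with hv
  have hu0 : 0 ≤ u := by positivity
  have hv0 : 0 ≤ v := by positivity
  have e1 : B * (24 * K * l ^ 3 / ε) = 24 * v := by
    rw [hv]
    ring
  -- This absorbs the dependence on `δ` into the gap term.
  have e2 : v * (ε * B / (l * δ)) = u := by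
    rw [hu, hv]
    field_simp
  have e3 : K * B * l ^ 3 * (1 + p + r) / ε = v * (1 + p + r) := by
    rw [hv]
    ring
  have b1 : 4 * B ^ 2 * K * q / δ * (1 + l) ≤ 384 * u := by
    calc 4 * B ^ 2 * K * q / δ * (1 + l) ≤ 4 * B ^ 2 * K * (32 * l) / δ * (3 * l) := by
          gcongr
          linarith
      _ = 384 * u := by
          rw [hu]
          ring
  have b2 : 4 * B * (24 * K * l ^ 3 / ε) * (1 + Real.log (4 * K * D / δ))
      ≤ 96 * (v * 3) + 96 * u + 96 * (v * (p + 2 * r)) := by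
    calc 4 * B * (24 * K * l ^ 3 / ε) * (1 + Real.log (4 * K * D / δ))
        = 96 * (v * (1 + Real.log (4 * K * D / δ))) := by linear_combination 4 * (1 + Real.log (4 * K * D / δ)) * e1
      _ ≤ 96 * (v * (1 + (2 + ε * B / (l * δ) + p + 2 * r))) := by gcongr
      _ = _ := by linear_combination 96 * e2
  rw [e1, e3]
  have hvp : 0 ≤ v * p := by positivity
  have hvr : 0 ≤ v * r := by positivity
  linarith

theorem regret_le {B₁ : ℝ} (hB : 0 < B₁) (hsmooth : M.IsBoundedSmooth B₁)
    (hmono : M.IsMonotone) (hα : 0 < α) (hβ : 0 < β) (hβ1 : β ≤ 1) (O : M.Oracle α β Ξ)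
    (F : M.FreeRule Ξ) {ε : ℝ} (hε : 0 < ε) {T : ℕ} (hT : 2 ≤ T) :
    M.regret O F T ε ≤ 480 * M.gapTerm α B₁ T
      + 312 * (m * M.K * B₁ * Real.log T ^ 3
          * (1 + Real.posLog (B₁ * M.K * Real.log T / (M.gapMax α * ε))
            + Real.posLog (M.gapMax α / B₁)) / ε)
      + 19 * (m * M.gapMax α) := by
  set D := M.gapMax α with hDdef
  have hD0 : 0 ≤ D := M.gapMax_nonneg α
  have hgap : ∀ S ∈ M.superArms, M.gap α S ≤ D := fun S hS => M.gap_le_gapMax α hS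
  set l := Real.log T with hl
  have hl0 : 0 < l := Real.log_pos (by exact_mod_cast hT)
  set Q := 1 + Real.posLog (B₁ * M.K * l / (D * ε)) + Real.posLog (D / B₁) with hQ
  have hQ0 : 0 ≤ Q := add_nonneg (add_nonneg zero_le_one Real.posLog_nonneg) Real.posLog_nonneg
  have hgt := M.gapTerm_nonneg α B₁ T
  have hmid : 0 ≤ (m : ℝ) * M.K * B₁ * l ^ 3 * Q / ε := by positivity
  -- For `T < m` the trivial bound `T D ≤ m D` suffices; otherwise `ln (m T) ≤ 2 ln T`, so `q ≤ 32
  -- ln T`.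
  rcases lt_or_ge T m with hmT | hmT
  · have h1 := M.regret_le_mul hα hβ1 O F T ε hgap
    have h2 : (T : ℝ) * D ≤ m * D := by
      gcongr
    have h3 : 0 ≤ (m : ℝ) * D := by positivity
    linarith
  -- `q` and `c` are chosen so that `√(q/n) + c/n` is twice the confidence radius.
  set q := 16 * Real.log (m * T) with hq
  set c := 24 * (M.K : ℝ) * l ^ 3 / ε with hc
  have hq0 : 0 ≤ q := by
    have : 0 ≤ Real.log ((m * T : ℕ) : ℝ) := Real.log_natCast_nonneg _
    push_cast at this
    positivity
  set φ : Fin m → ℕ → ℝ := fun i n =>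
    if 0 < M.gapMin α i then charge B₁ c q D M.K (M.gapMin α i) n else 0 with hφ
  have hφ0 : ∀ i n, 0 ≤ φ i n := by
    intro i n
    simp only [hφ]
    split_ifs with h
    · exact charge_nonneg hB.le (by positivity) hq0 hD0 (by positivity) h.le n
    · exact le_rfl
  have hcharge : ∀ s : State m, M.IsGood T ε s → ∀ S ∈ M.superArms,
      M.IsExplained α B₁ T ε s S → M.gap α S ≤ ∑ i ∈ S, φ i (s.count i) := by
    intro s hs S hS hex
    rcases le_or_gt (M.gap α S) 0 with hg | hg
    · exact hg.trans (Finset.sum_nonneg fun i _ => hφ0 _ _)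
    have hδ : ∀ i ∈ S, 0 < M.gapMin α i ∧ M.gapMin α i ≤ M.gap α S := fun i hi =>
      M.gapMin_pos_le hS hi hg
    refine (le_sum_charge S (M.card_le S hS) hB (c := c) (q := q) (by positivity) hq0 hg
      (hgap S hS) s.count hδ hex fun i _ hni => ?_).trans
        (Finset.sum_le_sum fun i hi => by simp only [hφ, if_pos (hδ i hi).1, le_refl])
    refine ((hs i).2 hni).trans (le_of_eq ?_)
    have hn : (0 : ℝ) < s.count i := by positivity
    have hsq : √(q / s.count i) = 2 * √(4 * Real.log (m * T) / s.count i) := by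
      rw [hq, show 16 * Real.log (m * T) / (s.count i : ℝ)
        = 2 ^ 2 * (4 * Real.log (m * T) / s.count i) by ring, Real.sqrt_mul (by norm_num),
        Real.sqrt_sq (by norm_num)]
    rw [hsq, radius, hc]
    field_simp
    ring
  refine (M.regret_le_of_charge hsmooth hmono hα hβ hβ1 O F hT hε hD0 hgap hφ0 hcharge).trans ?_
  set v := (M.K : ℝ) * B₁ * l ^ 3 * Q / ε with hv
  have hv0 : 0 ≤ v := by positivity
  have hsum : ∑ i, ∑ n ∈ Finset.range T, φ i n
      ≤ ∑ i : Fin m, (D + 480 * (if 0 < M.gapMin α i then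
          M.K * B₁ ^ 2 * l ^ 2 / M.gapMin α i else 0) + 312 * v) := by
    refine Finset.sum_le_sum fun i _ => ?_
    simp only [hφ]
    split_ifs with h
    · obtain ⟨S, hS, hi, hg⟩ := M.exists_of_gapMin_pos h
      have hK : (1 : ℝ) ≤ M.K := by
        exact_mod_cast (Finset.card_pos.2 ⟨i, hi⟩).trans_le (M.card_le S hS)
      have hm1 : (1 : ℝ) ≤ m := by exact_mod_cast i.pos
      have hT0 : (0 : ℝ) < T := by positivity
      have hmT' : (m : ℝ) ≤ T := by exact_mod_cast hmT
      refine sum_charge_le_posLog hB hK h ((M.gapMin_pos_le hS hi hg).2.trans (hgap S hS)) hε hT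
        hq0 ?_
      have : Real.log m ≤ Real.log T := Real.log_le_log (by linarith) hmT'
      rw [hq, Real.log_mul (by positivity) (by positivity)]
      linarith
    · simp only [Finset.sum_const_zero, mul_zero, add_zero]
      positivity
  have heq : ∑ i : Fin m, (D + 480 * (if 0 < M.gapMin α i then
        M.K * B₁ ^ 2 * l ^ 2 / M.gapMin α i else 0) + 312 * v)
      = m * D + 480 * M.gapTerm α B₁ T + 312 * (m * v) := by
    rw [Finset.sum_add_distrib, Finset.sum_add_distrib, ← Finset.mul_sum, ← Finset.sum_filter,
      gapTerm]
    simp only [Finset.sum_const, Finset.card_univ, Fintype.card_fin, nsmul_eq_mul]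
    ring
  have hmv : (m : ℝ) * M.K * B₁ * l ^ 3 * Q / ε = m * v := by
    rw [hv]
    ring
  rw [hmv]
  linarith

end SemiBandit
end DPCSB

/-! ### The two final bounds with one universal constant. -/

theorem mainTheorem3 :
    ∃ C : ℝ, 0 < C ∧
      ∀ (m : ℕ) (M : DPCSB.SemiBandit m) (B₁ : ℝ),
        0 < B₁ → M.IsBoundedSmooth B₁ → M.IsMonotone →
      ∀ (α β : ℝ), 0 < α → α ≤ 1 → 0 < β → β ≤ 1 →
      ∀ (Ξ : Type*) [MeasurableSpace Ξ] (O : M.Oracle α β Ξ) (F : M.FreeRule Ξ)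
        (ε : ℝ), 0 < ε → ∀ T : ℕ, 2 ≤ T →
        -- the bound for every horizon
        M.regret O F T ε ≤
            C * M.gapTerm α B₁ T
            + C * (m * M.K * B₁ * Real.log T ^ 3
                * (1 + Real.posLog (B₁ * M.K * Real.log T / (M.gapMax α * ε))
                  + Real.posLog (M.gapMax α / B₁)) / ε)
            + C * (m * M.gapMax α) ∧
        -- the bound for every sufficiently large horizon
        (Real.exp 1 ≤ B₁ * M.K * Real.log T / (M.gapMax α * ε) →
          M.gapMax α / B₁ ≤ B₁ * M.K * Real.log T / (M.gapMax α * ε) →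
          M.regret O F T ε ≤
            C * M.gapTerm α B₁ T
            + C * (m * M.K * B₁ * Real.log T ^ 3
                * Real.log (B₁ * M.K * Real.log T / (M.gapMax α * ε)) / ε)) := by
  refine ⟨1500, by norm_num, fun m M B₁ hB hsmooth hmono α β hα _ hβ hβ1 Ξ _ O F ε hε T hT => ?_⟩
  have hreg := M.regret_le hB hsmooth hmono hα hβ hβ1 O F hε hT
  have hgt := M.gapTerm_nonneg α B₁ T
  have hD0 := M.gapMax_nonneg α
  set D := M.gapMax α with hDdef
  set l := Real.log T with hl
  set x := B₁ * M.K * l / (D * ε) with hx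
  have hl2 : 1 / 2 < l := by
    have h1 := Real.log_two_gt_d9
    have h2 : Real.log 2 ≤ l := Real.log_le_log (by norm_num) (by exact_mod_cast hT)
    linarith
  have hl0 : 0 < l := by linarith
  have hp0 : 0 ≤ Real.posLog x := Real.posLog_nonneg
  have hr0 : 0 ≤ Real.posLog (D / B₁) := Real.posLog_nonneg
  set v := (m : ℝ) * M.K * B₁ * l ^ 3 / ε with hv
  have hv0 : 0 ≤ v := by positivity
  have hmid : ∀ y, (m : ℝ) * M.K * B₁ * l ^ 3 * y / ε = v * y := fun y => by
    rw [hv]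
    ring
  rw [hmid] at hreg ⊢
  rw [hmid]
  have hmD : 0 ≤ (m : ℝ) * D := by positivity
  constructor
  · have : 0 ≤ v * (1 + Real.posLog x + Real.posLog (D / B₁)) := by positivity
    linarith
  · intro hex hyx
    have hx1 : 1 ≤ x := le_trans (by linarith [Real.exp_one_gt_d9]) hex
    have hx0 : 0 < x := by linarith
    have hlogx : 1 ≤ Real.log x := (Real.le_log_iff_exp_le hx0).2 hex
    have hp : Real.posLog x = Real.log x := max_eq_right (by linarith)
    have hr : Real.posLog (D / B₁) ≤ Real.log x := by
      rw [← hp]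
      exact Real.posLog_le_posLog (by positivity) hyx
    -- If `D = 0`, the quotient `x` would be `0` by convention, contradicting `x ≥ 1`.
    have hDpos : 0 < D := by
      refine lt_of_le_of_ne hD0 fun h => ?_
      rw [hx, ← h, zero_mul, div_zero] at hx0
      exact lt_irrefl _ hx0
    -- From `x ≥ 1` and `4 l² ≥ 1` the term `m D` is absorbed into the privacy term, at total cost
    -- `312 * 3 + 19 * 4 ≤ 1500`.
    have hDle : D ≤ 4 * (M.K * B₁ * l ^ 3 / ε) := by
      have h1 : D * ε ≤ B₁ * M.K * l := by
        rwa [hx, one_le_div (by positivity)] at hx1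
      have h2 : B₁ * M.K * l * 1 ≤ B₁ * M.K * l * (4 * l ^ 2) := by
        gcongr
        nlinarith
      rw [← mul_div_assoc, le_div_iff₀ hε]
      linarith
    have hmDle : (m : ℝ) * D ≤ 4 * v := by
      calc (m : ℝ) * D ≤ m * (4 * (M.K * B₁ * l ^ 3 / ε)) := by gcongr
        _ = 4 * v := by
          rw [hv]
          ring
    have h3 : v * (1 + Real.posLog x + Real.posLog (D / B₁)) ≤ v * (3 * Real.log x) := by
      gcongr
      linarith
    have h4 : v * 1 ≤ v * Real.log x := by gcongr
    linarith
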